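/- Let $\{W(t)\}_{t\in[0,1]}$ be a family of binary memoryless symmetric (BMS) channels, i.e. channels from $\{\pm1\}$ to the extended reals $\overline{\mathbb R}$ such that the law of the output given input $-1$ is the law of the negative of the output given input $+1$. Assume that the family is ordered by degradation (for $0\le s\le t\le 1$, $W(t)$ is the composition of $W(s)$ with some further channel), that $W(0)$ is perfect (the output determines the input) and that $W(1)$ is uninformative (the output law does not depend on the input). Let $X_{\mathrm u}$ be uniform on $\{\pm1\}$, let $Y_{\mathrm u}(t)$ be its observation through $W(t)$, and put $$\mathcal H(t)=H(X_{\mathrm u}\mid Y_{\mathrm u}(t)),\qquad \mathcal M(t)=\mathbb E\big[(X_{\mathrm u}-\mathbb E[X_{\mathrm u}\mid Y_{\mathrm u}(t)])^2\big],$$ where entropy is measured in bits. Assume that $\mathcal H$ is absolutely continuous on $[0,1]$, with almost everywhere derivative $\mathcal H'$, and that $\mathcal M$ is strictly increasing on $[0,1]$. For each $n\in\mathbb N$ let $\boldsymbol X^{(n)}$ be a random vector in $\{\pm1\}^{N_n}$ with an arbitrary distribution (for instance, uniform on a code), and let $i_n\in\{0,\dots,N_n-1\}$ be an index (for instance $i_n=0$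 for all $n$). For parameters $s_0,\dots,s_{N_n-1}\in[0,1]$ let $\boldsymbol Y^{(n)}(s_0,\dots,s_{N_n-1})$ be the memoryless observation of $\boldsymbol X^{(n)}$ in which the $j$-th symbol is sent through $W(s_j)$. Write $\boldsymbol Y^{(n)}_{\sim i}(t)$ for the outputs at the positions other than $i$ when their parameters all equal $t$, and define the GEXIT function and the extrinsic MMSE function of the symbol $i=i_n$ by $$G^{(n)}(t)=\frac{\partial}{\partial s}H\big(\boldsymbol X^{(n)}\mid Y^{(n)}_{i}(s),\boldsymbol Y^{(n)}_{\sim i}(t)\big)\Big|_{s=t},\qquad M^{(n)}(t)=\mathbb E\Big[\big(X^{(n)}_{i}-\mathbb E[X^{(n)}_{i}\mid \boldsymbol Y^{(n)}_{\sim i}(t)]\big)^2\Big].$$ Then, for every $n$, the derivative defining $G^{(n)}(t)$ exists for almost every $t\in[0,1]$ and $G^{(n)}$ is integrable on $[0,1]$. Moreover, for every $t'\in(0,1)$, $$\int_0^{t'}G^{(n)}(s)\,ds\to0\iff M^{(n)}(s)\to0\ \text{ for all } s\in[0,t'),$$ $$\int_{t'}^{1}\big(\mathcal H'(s)-G^{(n)}(s)\big)\,ds\to0\iff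 M^{(n)}(s)\to1\ \text{ for all } s\in(t',1],$$ where the limits are for $n\to\infty$. -/

import Mathlib

open MeasureTheory ProbabilityTheory Set Filter Topology

noncomputable section

namespace BMS

/-! ### Information measures

The binary alphabet `{+1, -1}` is `ℤˣ`. -/

/-- Conditional Shannon entropy `H(X ∣ Y)`, in bits, of a random variable `X` with values in a
finite set: the expectation of the entropy of the conditional law of `X` given `Y`. -/
def condEntropy {Ω α β : Type*} [MeasurableSpace Ω] [Fintype α] [MeasurableSpace β]
    (μ : Measure Ω) (X : Ω → α) (Y : Ω → β) : ℝ :=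
  (∫ ω, ∑ x : α,
    Real.negMulLog ((μ⟦X ⁻¹' {x} | MeasurableSpace.comap Y inferInstance⟧) ω) ∂μ) / Real.log 2

/-- Minimum mean-squared error `‖X - 𝔼[X ∣ Y]‖₂²` in estimating `X` from `Y`. -/
def mmse {Ω β : Type*} [MeasurableSpace Ω] [MeasurableSpace β]
    (μ : Measure Ω) (X : Ω → ℝ) (Y : Ω → β) : ℝ :=
  ∫ ω, (X ω - (μ[X | MeasurableSpace.comap Y inferInstance]) ω) ^ 2 ∂μ

/-! ### Channels -/

instance : MeasurableSingletonClass ℤˣ :=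
  ⟨fun x => ⟨{(x : ℤ)}, measurableSet_singleton _, by ext y; simp [Units.ext_iff]⟩⟩

/-- A binary-input channel with output alphabet the extended reals is symmetric if
`w(y ∣ +1) = w(-y ∣ -1)`. -/
def IsSymmetric (K : Kernel ℤˣ EReal) : Prop :=
  K (-1) = (K 1).map (fun y => -y)

/-- `L` is stochastically degraded with respect to `K`: it is `K` followed by another channel. -/
def IsDegraded (L K : Kernel ℤˣ EReal) : Prop :=
  ∃ κ : Kernel EReal EReal, IsMarkovKernel κ ∧ L = κ ∘ₖ K

/-- A perfect channel: the input is determined by the output. -/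
def IsPerfect (K : Kernel ℤˣ EReal) : Prop :=
  ∃ f : EReal → ℤˣ, Measurable f ∧ ∀ x, ∀ᵐ y ∂(K x), f y = x

/-- An uninformative channel: the law of the output does not depend on the input. -/
def IsUninformative (K : Kernel ℤˣ EReal) : Prop :=
  ∀ x x', K x = K x'

/-- The channel with input `x : ι → {±1}` whose outputs are independent given `x`, the `j`-th
one being the output of the channel `K j` with input `x j`. -/
def memoryless {ι : Type*} [Fintype ι] (K : ι → Kernel ℤˣ EReal) :
    Kernel (ι → ℤˣ) (ι → EReal) where
  toFun x := Measure.pi fun j => K j (x j)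
  measurable' := measurable_of_countable _

instance {ι : Type*} [Fintype ι] (K : ι → Kernel ℤˣ EReal) [∀ j, IsMarkovKernel (K j)] :
    IsMarkovKernel (memoryless K) :=
  ⟨fun x => by change IsProbabilityMeasure (Measure.pi fun j => K j (x j)); infer_instance⟩

/-! ### Families of channels

A family is indexed by a real parameter of which only the values in `[0, 1]` matter. -/

/-- The joint law of a uniform input `X_u ∈ {±1}` and its observation `Y_u(t)` through `W t`. -/
def uniformLaw (W : ℝ → Kernel ℤˣ EReal) (t : ℝ) : Measure (ℤˣ × EReal) :=
  (PMF.uniformOfFintype ℤˣ).toMeasure ⊗ₘ W t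

/-- The entropy function `𝓗(t) = H(X_u ∣ Y_u(t))`. -/
def entropyFun (W : ℝ → Kernel ℤˣ EReal) (t : ℝ) : ℝ :=
  condEntropy (uniformLaw W t) Prod.fst Prod.snd

/-- The derivative `𝓗'` of the entropy function on `[0, 1]`. -/
def entropyDeriv (W : ℝ → Kernel ℤˣ EReal) (t : ℝ) : ℝ :=
  derivWithin (entropyFun W) (Icc 0 1) t

/-- The MMSE function `𝓜(t) = mmse(X_u ∣ Y_u(t))`. -/
def mmseFun (W : ℝ → Kernel ℤˣ EReal) (t : ℝ) : ℝ :=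
  mmse (uniformLaw W t) (fun ω => ((ω.1 : ℤ) : ℝ)) Prod.snd

/-- A family `(W t)`, `t ∈ [0, 1]`, of BMS channels that is ordered by degradation, from the
perfect channel at `t = 0` to the uninformative channel at `t = 1`, and absolutely continuous. -/
structure IsBMSFamily (W : ℝ → Kernel ℤˣ EReal) : Prop where
  markov : ∀ t ∈ Icc (0 : ℝ) 1, IsMarkovKernel (W t)
  symmetric : ∀ t ∈ Icc (0 : ℝ) 1, IsSymmetric (W t)
  degraded : ∀ s t : ℝ, 0 ≤ s → s ≤ t → t ≤ 1 → IsDegraded (W t) (W s)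
  perfect : IsPerfect (W 0)
  uninformative : IsUninformative (W 1)
  absolutelyContinuous : AbsolutelyContinuousOnInterval (entropyFun W) 0 1

/-! ### Vector inputs -/

/-- The joint law of an input `X ∈ {±1}^N` with distribution `p` and its observation
`Y(s_0, …, s_{N-1})`, in which the `j`-th symbol passes through the channel `W (s j)`. -/
def jointLaw {N : ℕ} (W : ℝ → Kernel ℤˣ EReal) (p : Measure (Fin N → ℤˣ)) (s : Fin N → ℝ) :
    Measure ((Fin N → ℤˣ) × (Fin N → EReal)) :=
  p ⊗ₘ memoryless fun j => W (s j)

/-- `s ↦ H(X ∣ Y_i(s), Y_{∼i}(t))`: the `i`-th channel has parameter `s`, the others `t`. -/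
def partialEntropy {N : ℕ} (W : ℝ → Kernel ℤˣ EReal) (p : Measure (Fin N → ℤˣ)) (i : Fin N)
    (t s : ℝ) : ℝ :=
  condEntropy (jointLaw W p (Function.update (fun _ => t) i s)) Prod.fst Prod.snd

/-- The GEXIT function `G_i(t) = ∂/∂s H(X ∣ Y_i(s), Y_{∼i}(t))` at `s = t`. -/
def gexit {N : ℕ} (W : ℝ → Kernel ℤˣ EReal) (p : Measure (Fin N → ℤˣ)) (i : Fin N) (t : ℝ) : ℝ :=
  derivWithin (partialEntropy W p i t) (Icc 0 1) t

/-- The extrinsic MMSE function `M_i(t) = ‖X_i - 𝔼[X_i ∣ Y_{∼i}(t)]‖₂²`. -/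
def extrinsicMMSE {N : ℕ} (W : ℝ → Kernel ℤˣ EReal) (p : Measure (Fin N → ℤˣ)) (i : Fin N)
    (t : ℝ) : ℝ :=
  mmse (jointLaw W p fun _ => t) (fun ω => ((ω.1 i : ℤ) : ℝ))
    (fun ω (j : {j : Fin N // j ≠ i}) => ω.2 j)

end BMS

end

/-! ### Series of monotone functions -/

/-! The GEXIT function is a series of weights times derivatives, and each weight is comparable to
the extrinsic MMSE.

By `BMS.exists_isSymmetricDensity` a BMS channel has densities `1 ± D` with respect to a symmetric
probability measure, where `D` is odd and is the posterior mean of a uniform input. With `c_k =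
1/((2k+1)(2k+2))`, so that `∑ c_k = log 2`, the power series of the binary entropy gives `𝓗(t) = ∑
e_k(t)`, where `e_k(t) = c_k (1 - 𝔼[D(t)^(2k+2)]) / log 2`. Let `z` be the posterior mean of `X_i`
given the other outputs, all at parameter `t`. The moments of `z D(s)` factor by independence, and
`BMS.hasSum_partialEntropy` gives `H(X ∣ Y_i(s), Y_{∼i}(t)) = C(t) + ∑ w_k(t) e_k(s)` with `w_k(t) =
1 - 𝔼[z^(2k+2)]`.

Degradation lowers even moments of posterior means (`BMS.IsPosteriorMean.moment_comp_le`), so all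
`e_k` and `w_k` increase on `[0, 1]`. Fubini's theorem on series of monotone functions then
differentiates both series term by term almost everywhere: `𝓗' = ∑ e_k'` and `G = ∑ w_k e_k'`, so `0
≤ G ≤ 𝓗'`.

The weight `w_0` is the extrinsic MMSE, and `w_0 ≤ w_k ≤ (k+1) w_0`, the upper bound being
Bernoulli's inequality. If `w_0 → 0` pointwise, then so does every `w_k`, and dominated convergence
gives `∫ G → 0`. Conversely `w_0(s) (e_0(t') - e_0(s)) ≤ ∫_0^{t'} G`, where the bracket is positive
because `e_0` is a positive multiple of the strictly increasing `𝓜`. The second equivalence is the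
same argument for `1 - w_k`; this is `tendsto_integral_iff_of_hasSum_mul_deriv`. -/

theorem AbsolutelyContinuousOnInterval.of_dist_le {f g : ℝ → ℝ} {a b : ℝ}
    (hg : AbsolutelyContinuousOnInterval g a b)
    (h : ∀ x ∈ uIcc a b, ∀ y ∈ uIcc a b, dist (f x) (f y) ≤ dist (g x) (g y)) :
    AbsolutelyContinuousOnInterval f a b := by
  rw [absolutelyContinuousOnInterval_iff] at hg ⊢
  intro ε hε
  obtain ⟨δ, hδ, H⟩ := hg ε hε
  refine ⟨δ, hδ, fun E hE hE' => lt_of_le_of_lt (Finset.sum_le_sum fun i hi => ?_) (H E hE hE')⟩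
  obtain ⟨h1, h2⟩ := hE.1 i hi
  exact h _ h1 _ h2

/-- Dominated convergence for series, with a dominating series whose sum converges. -/
theorem tendsto_hasSum_mul_of_nonneg {ι : Type*} {l : Filter ι} {f : ι → ℕ → ℝ} {f' w : ℕ → ℝ}
    {S T : ι → ℝ} {S' T' : ℝ} (hw0 : ∀ k, 0 ≤ w k) (hw1 : ∀ k, w k ≤ 1)
    (hf0 : ∀ᶠ i in l, ∀ k, 0 ≤ f i k) (hf : ∀ k, Tendsto (fun i => f i k) l (𝓝 (f' k)))
    (hS : ∀ᶠ i in l, HasSum (f i) (S i)) (hS' : HasSum f' S') (hSS' : Tendsto S l (𝓝 S'))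
    (hT : ∀ᶠ i in l, HasSum (fun k => w k * f i k) (T i))
    (hT' : HasSum (fun k => w k * f' k) T') : Tendsto T l (𝓝 T') := by
  -- No fixed summable bound on `f i` is available, only convergence of the total masses, as in
  -- Scheffé's lemma. Finite partial sums bound the limit from below for the weights `w`; applied to
  -- the weights `1 - w` they bound it from above.
  have hU' : HasSum (fun k => (1 - w k) * f' k) (S' - T') := by
    simpa [sub_mul] using hS'.sub hT'
  rw [tendsto_order]
  constructor
  · intro a ha
    obtain ⟨K, hK⟩ := (hT'.tendsto_sum_nat.eventually (lt_mem_nhds ha)).exists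
    have hlim : Tendsto (fun i => ∑ k ∈ Finset.range K, w k * f i k) l
        (𝓝 (∑ k ∈ Finset.range K, w k * f' k)) :=
      tendsto_finsetSum _ fun k _ => (hf k).const_mul _
    filter_upwards [hlim.eventually (lt_mem_nhds hK), hf0, hT] with i hi h0 hTi
    exact hi.trans_le (sum_le_hasSum _ (fun k _ => mul_nonneg (hw0 k) (h0 k)) hTi)
  · intro a ha
    have ha' : S' - a < S' - T' := by linarith
    obtain ⟨K, hK⟩ := (hU'.tendsto_sum_nat.eventually (lt_mem_nhds ha')).exists
    have hlim : Tendsto (fun i => S i - ∑ k ∈ Finset.range K, (1 - w k) * f i k) l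
        (𝓝 (S' - ∑ k ∈ Finset.range K, (1 - w k) * f' k)) :=
      hSS'.sub (tendsto_finsetSum _ fun k _ => (hf k).const_mul _)
    have hK' : S' - ∑ k ∈ Finset.range K, (1 - w k) * f' k < a := by linarith
    filter_upwards [hlim.eventually (gt_mem_nhds hK'), hf0, hT, hS] with i hi h0 hTi hSi
    have hUi : HasSum (fun k => (1 - w k) * f i k) (S i - T i) := by
      simpa [sub_mul] using hSi.sub hTi
    have := sum_le_hasSum (Finset.range K)
      (fun k _ => mul_nonneg (sub_nonneg.2 (hw1 k)) (h0 k)) hUi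
    linarith

theorem MonotoneOn.deriv_nonneg_of_mem_Ioo {f : ℝ → ℝ} {a b t : ℝ} (hf : MonotoneOn f (Icc a b))
    (ht : t ∈ Ioo a b) : 0 ≤ deriv f t := by
  rw [← derivWithin_of_mem_nhds (Icc_mem_nhds ht.1 ht.2)]
  exact hf.derivWithin_nonneg

/-- All increments of the terms have the same sign, so one of them is at most their sum. Hence each
term inherits the absolute continuity of the sum. -/
theorem dist_le_dist_of_hasSum_monotoneOn {e : ℕ → ℝ → ℝ} {E : ℝ → ℝ} {s : Set ℝ}
    (he : ∀ k, MonotoneOn (e k) s) (hE : ∀ t ∈ s, HasSum (fun k => e k t) (E t)) (k : ℕ)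
    {x y : ℝ} (hx : x ∈ s) (hy : y ∈ s) : dist (e k x) (e k y) ≤ dist (E x) (E y) := by
  wlog hxy : x ≤ y generalizing x y
  · rw [dist_comm (e k x), dist_comm (E x)]
    exact this hy hx (le_of_not_ge hxy)
  have h1 := (hE y hy).sub (hE x hx)
  have h2 : e k y - e k x ≤ E y - E x :=
    le_hasSum h1 k fun j _ => sub_nonneg.2 (he j hx hy hxy)
  have h3 : 0 ≤ e k y - e k x := sub_nonneg.2 (he k hx hy hxy)
  rw [dist_comm, dist_comm (E x), Real.dist_eq, Real.dist_eq, abs_of_nonneg h3]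
  exact h2.trans (le_abs_self _)

section SeriesOfMonotone

variable {e : ℕ → ℝ → ℝ} {E : ℝ → ℝ}

theorem absolutelyContinuousOnInterval_of_hasSum_monotoneOn
    (he : ∀ k, MonotoneOn (e k) (Icc 0 1))
    (hE : ∀ t ∈ Icc (0 : ℝ) 1, HasSum (fun k => e k t) (E t))
    (hac : AbsolutelyContinuousOnInterval E 0 1) (k : ℕ) :
    AbsolutelyContinuousOnInterval (e k) 0 1 := by
  refine hac.of_dist_le fun x hx y hy => ?_
  rw [uIcc_of_le zero_le_one] at hx hy
  exact dist_le_dist_of_hasSum_monotoneOn he hE k hx hy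

/-- Fubini's theorem on termwise differentiation of series of monotone functions, for an
absolutely continuous sum. -/
theorem ae_hasSum_deriv_of_monotoneOn (he : ∀ k, MonotoneOn (e k) (Icc 0 1))
    (hE : ∀ t ∈ Icc (0 : ℝ) 1, HasSum (fun k => e k t) (E t))
    (hac : AbsolutelyContinuousOnInterval E 0 1) :
    ∀ᵐ t : ℝ, t ∈ Ioo (0 : ℝ) 1 → (∀ k, DifferentiableAt ℝ (e k) t) ∧ DifferentiableAt ℝ E t ∧
      HasSum (fun k => deriv (e k) t) (deriv E t) := by
  have hack := absolutelyContinuousOnInterval_of_hasSum_monotoneOn he hE hac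
  have hsub : Ioo (0 : ℝ) 1 ⊆ uIcc 0 1 := by
    rw [uIcc_of_le zero_le_one]; exact Ioo_subset_Icc_self
  have hdk : ∀ᵐ t : ℝ, ∀ k, t ∈ uIcc (0 : ℝ) 1 → DifferentiableAt ℝ (e k) t :=
    ae_all_iff.2 fun k => (hack k).ae_differentiableAt
  have hdE := hac.ae_differentiableAt
  -- The tails are again monotone and absolutely continuous, so their derivatives are nonnegative on
  -- the interior with integral `R n 1 - R n 0 → 0`. The infimum over `n` of these derivatives
  -- therefore vanishes almost everywhere.
  set R : ℕ → ℝ → ℝ := fun n t => E t - ∑ k ∈ Finset.range n, e k t with hR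
  have hRac : ∀ n, AbsolutelyContinuousOnInterval (R n) 0 1 := by
    intro n
    induction n with
    | zero => simpa [hR] using hac
    | succ n ih =>
      have : R (n + 1) = R n - e n := by
        ext t; simp [hR, Finset.sum_range_succ]; ring
      rw [this]; exact ih.sub (hack n)
  have hRmono : ∀ n, MonotoneOn (R n) (Icc 0 1) := by
    intro n x hx y hy hxy
    have h := sum_le_hasSum (Finset.range n) (fun k _ => sub_nonneg.2 (he k hx hy hxy))
      ((hE y hy).sub (hE x hx))
    rw [Finset.sum_sub_distrib] at h
    simp only [hR]; linarith
  have hRderiv : ∀ᵐ t : ℝ, t ∈ Ioo (0 : ℝ) 1 →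
      ∀ n, deriv (R n) t = deriv E t - ∑ k ∈ Finset.range n, deriv (e k) t := by
    filter_upwards [hdk, hdE] with t h1 h2 ht n
    have := (h2 (hsub ht)).hasDerivAt.sub
      (HasDerivAt.fun_sum (u := Finset.range n) fun k _ => (h1 k (hsub ht)).hasDerivAt)
    exact this.deriv
  have hlint : ∫⁻ t in Ioo (0 : ℝ) 1, ⨅ n, ENNReal.ofReal (deriv (R n) t) = 0 := by
    have hlim : Tendsto (fun n => ENNReal.ofReal (R n 1 - R n 0)) atTop (𝓝 0) := by
      have h1 : Tendsto (fun n => R n 1 - R n 0) atTop (𝓝 ((E 1 - E 1) - (E 0 - E 0))) :=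
        ((hE 1 (by simp)).tendsto_sum_nat.const_sub _).sub
          ((hE 0 (by simp)).tendsto_sum_nat.const_sub _)
      simpa using ENNReal.tendsto_ofReal h1
    refine le_antisymm (ge_of_tendsto' hlim fun n => ?_) zero_le
    calc ∫⁻ t in Ioo (0 : ℝ) 1, ⨅ n, ENNReal.ofReal (deriv (R n) t)
        ≤ ∫⁻ t in Ioo (0 : ℝ) 1, ENNReal.ofReal (deriv (R n) t) :=
          lintegral_mono fun t => iInf_le _ n
      _ = ENNReal.ofReal (∫ t in Ioo (0 : ℝ) 1, deriv (R n) t) := by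
          rw [ofReal_integral_eq_lintegral_ofReal]
          · have := (hRac n).intervalIntegrable_deriv
            rw [intervalIntegrable_iff_integrableOn_Ioo_of_le zero_le_one] at this
            exact this
          · exact ae_restrict_of_forall_mem measurableSet_Ioo
              fun t ht => (hRmono n).deriv_nonneg_of_mem_Ioo ht
      _ ≤ _ := by
          rw [← (hRac n).integral_deriv_eq_sub, intervalIntegral.integral_of_le zero_le_one,
            integral_Ioc_eq_integral_Ioo]
  rw [lintegral_eq_zero_iff (Measurable.iInf fun n => (measurable_deriv _).ennreal_ofReal)]
    at hlint
  have hlint' := (ae_restrict_iff' measurableSet_Ioo).1 hlint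
  filter_upwards [hlint', hdk, hdE, hRderiv] with t h0 h1 h2 h3 ht
  refine ⟨fun k => h1 k (hsub ht), h2 (hsub ht), ?_⟩
  have h0 := h0 ht
  have hpos : ∀ k, 0 ≤ deriv (e k) t := fun k => (he k).deriv_nonneg_of_mem_Ioo ht
  have hle : ∀ n, ∑ k ∈ Finset.range n, deriv (e k) t ≤ deriv E t := fun n => by
    have := (hRmono n).deriv_nonneg_of_mem_Ioo ht
    rw [h3 ht n] at this; linarith
  have hsum : Summable fun k => deriv (e k) t := summable_of_sum_range_le hpos hle
  refine (hsum.hasSum_iff).2 (le_antisymm (hsum.tsum_le_of_sum_range_le hle) ?_)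
  by_contra! hlt
  -- A positive defect in the differentiated series would bound every tail derivative from below.
  have : ENNReal.ofReal (deriv E t - ∑' k, deriv (e k) t) ≤
      ⨅ n, ENNReal.ofReal (deriv (R n) t) := by
    refine le_iInf fun n => ENNReal.ofReal_le_ofReal ?_
    rw [h3 ht n]
    have := hsum.sum_le_tsum (Finset.range n) fun k _ => hpos k
    linarith
  simp only [Pi.zero_apply] at h0
  rw [h0, nonpos_iff_eq_zero, ENNReal.ofReal_eq_zero] at this
  linarith

/-- Termwise differentiation persists when the terms are multiplied by weights in `[0, 1]`. -/
theorem hasDerivAt_of_hasSum_mul_monotoneOn {F : ℝ → ℝ} {w : ℕ → ℝ} {t F' : ℝ}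
    (he : ∀ k, MonotoneOn (e k) (Icc 0 1))
    (hE : ∀ s ∈ Icc (0 : ℝ) 1, HasSum (fun k => e k s) (E s)) (ht : t ∈ Ioo (0 : ℝ) 1)
    (hdk : ∀ k, DifferentiableAt ℝ (e k) t) (hdE : DifferentiableAt ℝ E t)
    (hsum : HasSum (fun k => deriv (e k) t) (deriv E t))
    (hw0 : ∀ k, 0 ≤ w k) (hw1 : ∀ k, w k ≤ 1)
    (hF : ∀ s ∈ Icc (0 : ℝ) 1, HasSum (fun k => w k * e k s) (F s))
    (hF' : HasSum (fun k => w k * deriv (e k) t) F') : HasDerivAt F F' t := by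
  rw [hasDerivAt_iff_tendsto_slope]
  have hmem : ∀ᶠ s in 𝓝[≠] t, s ∈ Icc (0 : ℝ) 1 :=
    nhdsWithin_le_nhds (Icc_mem_nhds ht.1 ht.2)
  have ht' : t ∈ Icc (0 : ℝ) 1 := Ioo_subset_Icc_self ht
  -- Monotonicity makes the difference quotients nonnegative, and their total is the difference
  -- quotient of `E`, which converges: exactly the setting of the Scheffé-type lemma.
  refine tendsto_hasSum_mul_of_nonneg (f := fun s k => slope (e k) t s) (S := slope E t) hw0 hw1
    ?_ (fun k => hasDerivAt_iff_tendsto_slope.1 (hdk k).hasDerivAt) ?_ hsum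
    (hasDerivAt_iff_tendsto_slope.1 hdE.hasDerivAt) ?_ hF'
  · filter_upwards [hmem] with s hs k
    exact (he k).slope_nonneg ht' hs
  · filter_upwards [hmem] with s hs
    simp only [slope_def_field]
    exact ((hE s hs).sub (hE t ht')).div_const _
  · filter_upwards [hmem] with s hs
    simp only [slope_def_field]
    have h : (fun k => w k * ((e k s - e k t) / (s - t))) =
        fun k => (w k * e k s - w k * e k t) / (s - t) := by ext k; ring
    rw [h]
    exact ((hF s hs).sub (hF t ht')).div_const _

theorem aestronglyMeasurable_of_ae_hasSum_mul_deriv {v : ℕ → ℝ → ℝ} {g : ℝ → ℝ}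
    (hv : ∀ k, AEMeasurable (v k) (volume.restrict (Ioo 0 1)))
    (hg : ∀ᵐ t : ℝ, t ∈ Ioo (0 : ℝ) 1 → HasSum (fun k => v k t * deriv (e k) t) (g t)) :
    AEStronglyMeasurable g (volume.restrict (Ioo 0 1)) := by
  refine AEMeasurable.aestronglyMeasurable (aemeasurable_of_tendsto_metrizable_ae atTop
    (f := fun n t => ∑ k ∈ Finset.range n, v k t * deriv (e k) t) (fun n => ?_) ?_)
  · exact Finset.aemeasurable_fun_sum _ fun k _ => (hv k).mul (measurable_deriv _).aemeasurable
  · rw [ae_restrict_iff' measurableSet_Ioo]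
    filter_upwards [hg] with t h ht using (h ht).tendsto_sum_nat

/-- Weights in `[0, 1]` squeeze `g` between `0` and `deriv E`, which is integrable by absolute
continuity. -/
theorem integrableOn_of_ae_hasSum_mul_deriv {v : ℕ → ℝ → ℝ} {g : ℝ → ℝ}
    (he : ∀ k, MonotoneOn (e k) (Icc 0 1))
    (hE : ∀ t ∈ Icc (0 : ℝ) 1, HasSum (fun k => e k t) (E t))
    (hac : AbsolutelyContinuousOnInterval E 0 1)
    (hvm : ∀ k, AEMeasurable (v k) (volume.restrict (Ioo 0 1)))
    (hv : ∀ k, ∀ t ∈ Icc (0 : ℝ) 1, v k t ∈ Icc (0 : ℝ) 1)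
    (hg : ∀ᵐ t : ℝ, t ∈ Ioo (0 : ℝ) 1 → HasSum (fun k => v k t * deriv (e k) t) (g t)) :
    (∀ᵐ t : ℝ, t ∈ Ioo (0 : ℝ) 1 → 0 ≤ g t ∧ g t ≤ deriv E t) ∧ IntervalIntegrable g volume 0 1 := by
  have hb : ∀ᵐ t : ℝ, t ∈ Ioo (0 : ℝ) 1 → 0 ≤ g t ∧ g t ≤ deriv E t := by
    filter_upwards [hg, ae_hasSum_deriv_of_monotoneOn he hE hac] with t h1 h2 ht
    have hd : ∀ k, 0 ≤ deriv (e k) t := fun k => (he k).deriv_nonneg_of_mem_Ioo ht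
    have hvt := fun k => hv k t (Ioo_subset_Icc_self ht)
    exact ⟨(h1 ht).nonneg fun k => mul_nonneg (hvt k).1 (hd k),
      hasSum_le (fun k => mul_le_of_le_one_left (hd k) (hvt k).2) (h1 ht) (h2 ht).2.2⟩
  refine ⟨hb, ?_⟩
  have hint := hac.intervalIntegrable_deriv
  rw [intervalIntegrable_iff_integrableOn_Ioo_of_le zero_le_one] at hint ⊢
  refine Integrable.mono' hint (aestronglyMeasurable_of_ae_hasSum_mul_deriv hvm hg) ?_
  rw [ae_restrict_iff' measurableSet_Ioo]
  filter_upwards [hb] with t h ht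
  rw [Real.norm_eq_abs, abs_of_nonneg (h ht).1]
  exact (h ht).2

/-- Only the term `k = 0`, the one tied to the MMSE, is kept: `g ≥ V * deriv (e 0)` on `(x, y)`, and
the right side integrates exactly because `e 0` is absolutely continuous. Enlarging the interval
costs nothing since `g ≥ 0`. -/
theorem le_integral_of_ae_hasSum_mul_deriv {v : ℕ → ℝ → ℝ} {g : ℝ → ℝ} {a b x y V : ℝ}
    (he : ∀ k, MonotoneOn (e k) (Icc 0 1))
    (hE : ∀ t ∈ Icc (0 : ℝ) 1, HasSum (fun k => e k t) (E t))
    (hac : AbsolutelyContinuousOnInterval E 0 1)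
    (hvm : ∀ k, AEMeasurable (v k) (volume.restrict (Ioo 0 1)))
    (hv : ∀ k, ∀ t ∈ Icc (0 : ℝ) 1, v k t ∈ Icc (0 : ℝ) 1)
    (hg : ∀ᵐ t : ℝ, t ∈ Ioo (0 : ℝ) 1 → HasSum (fun k => v k t * deriv (e k) t) (g t))
    (ha : 0 ≤ a) (hax : a ≤ x) (hxy : x ≤ y) (hyb : y ≤ b) (hb : b ≤ 1)
    (hV : ∀ t ∈ Ioo x y, V ≤ v 0 t) :
    V * (e 0 y - e 0 x) ≤ ∫ t in a..b, g t := by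
  obtain ⟨hgb, hgi⟩ := integrableOn_of_ae_hasSum_mul_deriv he hE hac hvm hv hg
  have hsubxy : uIcc x y ⊆ uIcc 0 1 := by
    rw [uIcc_of_le hxy, uIcc_of_le zero_le_one]
    exact Icc_subset_Icc (ha.trans hax) (hyb.trans hb)
  have h0 := (absolutelyContinuousOnInterval_of_hasSum_monotoneOn he hE hac 0).mono hsubxy
  have hgab : IntervalIntegrable g volume a b := hgi.mono_set (by
    rw [uIcc_of_le (hax.trans (hxy.trans hyb)), uIcc_of_le zero_le_one]
    exact Icc_subset_Icc ha hb)
  have hgxy : IntervalIntegrable g volume x y := hgi.mono_set hsubxy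
  calc V * (e 0 y - e 0 x) = ∫ t in x..y, V * deriv (e 0) t := by
        rw [intervalIntegral.integral_const_mul, h0.integral_deriv_eq_sub]
    _ ≤ ∫ t in x..y, g t := by
        refine intervalIntegral.integral_mono_ae_restrict hxy
          (h0.intervalIntegrable_deriv.const_mul V) hgxy ?_
        rw [Filter.EventuallyLE, ← restrict_Ioo_eq_restrict_Icc,
          ae_restrict_iff' measurableSet_Ioo]
        filter_upwards [hg] with t ht htxy
        have ht01 : t ∈ Ioo (0 : ℝ) 1 :=
          ⟨(ha.trans hax).trans_lt htxy.1, htxy.2.trans_le (hyb.trans hb)⟩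
        have hd : ∀ k, 0 ≤ deriv (e k) t := fun k => (he k).deriv_nonneg_of_mem_Ioo ht01
        calc V * deriv (e 0) t ≤ v 0 t * deriv (e 0) t :=
              mul_le_mul_of_nonneg_right (hV t htxy) (hd 0)
          _ ≤ g t := le_hasSum (ht ht01) 0 fun k _ =>
              mul_nonneg (hv k t (Ioo_subset_Icc_self ht01)).1 (hd k)
    _ ≤ ∫ t in a..b, g t := by
        refine intervalIntegral.integral_mono_interval hax hxy hyb ?_ hgab
        rw [Filter.EventuallyLE, ← restrict_Ioo_eq_restrict_Ioc,
          ae_restrict_iff' measurableSet_Ioo]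
        filter_upwards [hgb] with t ht htab
        exact (ht ⟨ha.trans_lt htab.1, htab.2.trans_le hb⟩).1

/-- Dominated convergence is used twice: for the series at fixed `t`, dominated by `deriv (e k) t`,
and then for the integral, dominated by `deriv E`. -/
theorem tendsto_integral_of_ae_hasSum_mul_deriv {v : ℕ → ℕ → ℝ → ℝ} {g : ℕ → ℝ → ℝ} {a b : ℝ}
    (he : ∀ k, MonotoneOn (e k) (Icc 0 1))
    (hE : ∀ t ∈ Icc (0 : ℝ) 1, HasSum (fun k => e k t) (E t))
    (hac : AbsolutelyContinuousOnInterval E 0 1)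
    (hvm : ∀ n k, AEMeasurable (v n k) (volume.restrict (Ioo 0 1)))
    (hv : ∀ n k, ∀ t ∈ Icc (0 : ℝ) 1, v n k t ∈ Icc (0 : ℝ) 1)
    (hg : ∀ n, ∀ᵐ t : ℝ, t ∈ Ioo (0 : ℝ) 1 →
      HasSum (fun k => v n k t * deriv (e k) t) (g n t))
    (ha : 0 ≤ a) (hab : a ≤ b) (hb : b ≤ 1)
    (hlim : ∀ t ∈ Ioo a b, ∀ k, Tendsto (fun n => v n k t) atTop (𝓝 0)) :
    Tendsto (fun n => ∫ t in a..b, g n t) atTop (𝓝 0) := by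
  have hsub : Ioo a b ⊆ Ioo 0 1 := Ioo_subset_Ioo ha hb
  have hfact := fun n => integrableOn_of_ae_hasSum_mul_deriv he hE hac (hvm n) (hv n) (hg n)
  have hint := hac.intervalIntegrable_deriv
  rw [intervalIntegrable_iff_integrableOn_Ioo_of_le zero_le_one] at hint
  simp_rw [intervalIntegral.integral_of_le hab, integral_Ioc_eq_integral_Ioo]
  have : (0 : ℝ) = ∫ t in Ioo a b, (0 : ℝ) := by simp
  rw [this]
  refine tendsto_integral_of_dominated_convergence (deriv E) (fun n => ?_)
    (hint.mono_set hsub) (fun n => ?_) ?_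
  · exact (aestronglyMeasurable_of_ae_hasSum_mul_deriv (hvm n) (hg n)).mono_set hsub
  · rw [ae_restrict_iff' measurableSet_Ioo]
    filter_upwards [(hfact n).1] with t h ht
    rw [Real.norm_eq_abs, abs_of_nonneg (h (hsub ht)).1]
    exact (h (hsub ht)).2
  · rw [ae_restrict_iff' measurableSet_Ioo]
    filter_upwards [ae_all_iff.2 hg, ae_hasSum_deriv_of_monotoneOn he hE hac] with t h1 h2 ht
    have hd : ∀ k, 0 ≤ deriv (e k) t := fun k => (he k).deriv_nonneg_of_mem_Ioo (hsub ht)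
    have h3 : Tendsto (fun n => ∑' k, v n k t * deriv (e k) t) atTop (𝓝 (∑' _ : ℕ, (0 : ℝ))) := by
      refine tendsto_tsum_of_dominated_convergence (h2 (hsub ht)).2.2.summable (fun k => ?_) ?_
      · simpa using (hlim t ht k).mul_const (deriv (e k) t)
      · refine Eventually.of_forall fun n k => ?_
        have := hv n k t (Ioo_subset_Icc_self (hsub ht))
        rw [Real.norm_eq_abs, abs_of_nonneg (mul_nonneg this.1 (hd k))]
        exact mul_le_of_le_one_left (hd k) this.2
    simpa [fun n => (h1 n (hsub ht)).tsum_eq] using h3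

end SeriesOfMonotone

/-! ### The analytic form of the two equivalences. -/

theorem MonotoneOn.aemeasurable_restrict_Ioo {f : ℝ → ℝ} (hf : MonotoneOn f (Icc 0 1)) :
    AEMeasurable f (volume.restrict (Ioo 0 1)) :=
  aemeasurable_restrict_of_monotoneOn measurableSet_Ioo (hf.mono Ioo_subset_Icc_self)

theorem tendsto_zero_of_mul_le {u I : ℕ → ℝ} {c : ℝ} (hc : 0 < c) (hu : ∀ n, 0 ≤ u n)
    (h : ∀ n, u n * c ≤ I n) (hI : Tendsto I atTop (𝓝 0)) : Tendsto u atTop (𝓝 0) := by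
  refine squeeze_zero hu (fun n => (le_div_iff₀ hc).2 (h n)) ?_
  simpa using hI.div_const c

/-- The two equivalences, for functions `g n = ∑ w n k * e k'` with monotone weights. -/
theorem tendsto_integral_iff_of_hasSum_mul_deriv {e : ℕ → ℝ → ℝ} {E : ℝ → ℝ}
    {w : ℕ → ℕ → ℝ → ℝ} {g : ℕ → ℝ → ℝ}
    (he : ∀ k, MonotoneOn (e k) (Icc 0 1)) (he0 : StrictMonoOn (e 0) (Icc 0 1))
    (hE : ∀ t ∈ Icc (0 : ℝ) 1, HasSum (fun k => e k t) (E t))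
    (hac : AbsolutelyContinuousOnInterval E 0 1)
    (hw : ∀ n k, ∀ t ∈ Icc (0 : ℝ) 1, w n k t ∈ Icc (0 : ℝ) 1)
    (hwm : ∀ n k, MonotoneOn (w n k) (Icc 0 1))
    (hwl : ∀ n k, ∀ t ∈ Icc (0 : ℝ) 1, w n 0 t ≤ w n k t)
    (hwu : ∀ n k, ∀ t ∈ Icc (0 : ℝ) 1, w n k t ≤ (k + 1) * w n 0 t)
    (hg : ∀ n, ∀ᵐ t : ℝ, t ∈ Ioo (0 : ℝ) 1 →
      HasSum (fun k => w n k t * deriv (e k) t) (g n t)) {t' : ℝ} (ht' : t' ∈ Ioo (0 : ℝ) 1) :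
    (Tendsto (fun n => ∫ s in (0 : ℝ)..t', g n s) atTop (𝓝 0) ↔
        ∀ s ∈ Ico 0 t', Tendsto (fun n => w n 0 s) atTop (𝓝 0)) ∧
      (Tendsto (fun n => ∫ s in t'..(1 : ℝ), (deriv E s - g n s)) atTop (𝓝 0) ↔
        ∀ s ∈ Ioc t' 1, Tendsto (fun n => w n 0 s) atTop (𝓝 1)) := by
  have hvm : ∀ n k, AEMeasurable (w n k) (volume.restrict (Ioo 0 1)) :=
    fun n k => (hwm n k).aemeasurable_restrict_Ioo
  have hvm' : ∀ n k, AEMeasurable (fun t => 1 - w n k t) (volume.restrict (Ioo 0 1)) :=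
    fun n k => (hvm n k).const_sub 1
  have hw' : ∀ n k, ∀ t ∈ Icc (0 : ℝ) 1, 1 - w n k t ∈ Icc (0 : ℝ) 1 := fun n k t ht => by
    have := hw n k t ht
    exact ⟨by linarith [this.2], by linarith [this.1]⟩
  -- The complementary weights `1 - w` represent `deriv E - g`, so the second equivalence follows
  -- from the same two lemmas.
  have hg' : ∀ n, ∀ᵐ t : ℝ, t ∈ Ioo (0 : ℝ) 1 →
      HasSum (fun k => (1 - w n k t) * deriv (e k) t) (deriv E t - g n t) := fun n => by
    filter_upwards [hg n, ae_hasSum_deriv_of_monotoneOn he hE hac] with t h1 h2 ht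
    simpa [sub_mul] using (h2 ht).2.2.sub (h1 ht)
  obtain ⟨h0, h1⟩ := ht'
  refine ⟨⟨fun h s hs => ?_, fun h => ?_⟩, ⟨fun h s hs => ?_, fun h => ?_⟩⟩
  · have hs01 : s ∈ Icc (0 : ℝ) 1 := ⟨hs.1, (hs.2.trans h1).le⟩
    -- The increasing weight `w n 0` is at least its value at `s` on all of `(s, t')`, over which `e
    -- 0` has a positive increment independent of `n`.
    refine tendsto_zero_of_mul_le (sub_pos.2 (he0 hs01 ⟨h0.le, h1.le⟩ hs.2))
      (fun n => (hw n 0 s hs01).1) (fun n => ?_) h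
    exact le_integral_of_ae_hasSum_mul_deriv he hE hac (hvm n) (hw n) (hg n) le_rfl hs.1 hs.2.le
      le_rfl h1.le fun t ht =>
        hwm n 0 hs01 ⟨hs.1.trans ht.1.le, (ht.2.trans h1).le⟩ ht.1.le
  · refine tendsto_integral_of_ae_hasSum_mul_deriv he hE hac hvm hw hg le_rfl h0.le h1.le
      fun t ht k => ?_
    have ht01 : t ∈ Icc (0 : ℝ) 1 := ⟨ht.1.le, (ht.2.trans h1).le⟩
    -- The factor `k + 1` is unbounded in `k`, but only the limit in `n` at fixed `k` is needed.
    refine squeeze_zero (fun n => (hw n k t ht01).1) (fun n => hwu n k t ht01) ?_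
    simpa using (h t ⟨ht.1.le, ht.2⟩).const_mul ((k : ℝ) + 1)
  · have hs01 : s ∈ Icc (0 : ℝ) 1 := ⟨(h0.trans hs.1).le, hs.2⟩
    have : Tendsto (fun n => 1 - w n 0 s) atTop (𝓝 0) := by
      refine tendsto_zero_of_mul_le (sub_pos.2 (he0 ⟨h0.le, h1.le⟩ hs01 hs.1))
        (fun n => (hw' n 0 s hs01).1) (fun n => ?_) h
      exact le_integral_of_ae_hasSum_mul_deriv he hE hac (hvm' n) (hw' n) (hg' n) h0.le le_rfl
        hs.1.le hs.2 le_rfl fun t ht => sub_le_sub_left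
          (hwm n 0 ⟨(h0.trans ht.1).le, (ht.2.le.trans hs.2)⟩ hs01 ht.2.le) 1
    simpa using this.const_sub 1
  · refine tendsto_integral_of_ae_hasSum_mul_deriv he hE hac hvm' hw' hg' h0.le h1.le le_rfl
      fun t ht k => ?_
    have ht01 : t ∈ Icc (0 : ℝ) 1 := ⟨(h0.trans ht.1).le, ht.2.le⟩
    refine squeeze_zero (fun n => (hw' n k t ht01).1)
      (fun n => sub_le_sub_left (hwl n k t ht01) 1) ?_
    simpa using (h t ⟨ht.1, ht.2.le⟩).const_sub 1

noncomputable section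

namespace BMS

/-! ### The binary entropy series -/

/-- `log 2 - h((1 + u) / 2)`, where `h` is the binary entropy function in nats. -/
def entropyGap (u : ℝ) : ℝ := -(Real.negMulLog (1 + u) + Real.negMulLog (1 - u)) / 2

/-- The coefficients of the even power series `entropyGap u = ∑ c k * u ^ (2 * k + 2)`. -/
def gapCoeff (k : ℕ) : ℝ := 1 / ((2 * k + 1) * (2 * k + 2))

theorem gapCoeff_pos (k : ℕ) : 0 < gapCoeff k := by unfold gapCoeff; positivity

theorem summable_gapCoeff : Summable gapCoeff := by
  refine Summable.of_nonneg_of_le (fun k => (gapCoeff_pos k).le) (fun k => ?_)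
    ((summable_nat_add_iff 1).2 (Real.summable_one_div_nat_pow.2 one_lt_two))
  unfold gapCoeff
  push_cast
  gcongr
  nlinarith [(Nat.cast_nonneg k : (0 : ℝ) ≤ k)]

theorem continuous_entropyGap : Continuous entropyGap := by
  unfold entropyGap
  have := Real.continuous_negMulLog
  fun_prop

theorem entropyGap_neg (u : ℝ) : entropyGap (-u) = entropyGap u := by
  unfold entropyGap
  rw [sub_neg_eq_add, ← sub_eq_add_neg, add_comm (Real.negMulLog (1 - u))]

/-- The gap is `u/2` times `log (1+u) - log (1-u)` plus half of `log (1-u²)`. The two logarithmic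
series contribute `1/(2k+1)` and `-1/(2k+2)` to the coefficient of `u^(2k+2)`. -/
theorem hasSum_entropyGap_of_abs_lt_one {u : ℝ} (hu : |u| < 1) :
    HasSum (fun k => gapCoeff k * u ^ (2 * k + 2)) (entropyGap u) := by
  obtain ⟨h1, h2⟩ := abs_lt.1 hu
  have hsq : |u ^ 2| < 1 := by
    rw [abs_pow]; exact pow_lt_one₀ (abs_nonneg _) hu two_ne_zero
  have ha := (Real.hasSum_log_sub_log_of_abs_lt_one hu).mul_left (u / 2)
  have hb := (Real.hasSum_pow_div_log_of_abs_lt_one hsq).mul_left (1 / 2)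
  have hlog : Real.log (1 - u ^ 2) = Real.log (1 + u) + Real.log (1 - u) := by
    rw [← Real.log_mul (by linarith) (by linarith)]
    congr 1; ring
  have hval : u / 2 * (Real.log (1 + u) - Real.log (1 - u)) - 1 / 2 * -Real.log (1 - u ^ 2) =
      entropyGap u := by
    rw [hlog, entropyGap, Real.negMulLog, Real.negMulLog]; ring
  rw [← hval]
  refine (ha.sub hb).congr_fun fun k => ?_
  have h3 : (2 * (k : ℝ) + 1) ≠ 0 := by positivity
  have h4 : ((k : ℝ) + 1) ≠ 0 := by positivity
  unfold gapCoeff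
  rw [← pow_mul]
  field_simp
  ring

theorem norm_gapCoeff_mul_pow_le {u : ℝ} (hu : u ∈ Icc (-1 : ℝ) 1) (k : ℕ) :
    ‖gapCoeff k * u ^ (2 * k + 2)‖ ≤ gapCoeff k := by
  rw [norm_mul, Real.norm_of_nonneg (gapCoeff_pos k).le, norm_pow, Real.norm_eq_abs]
  exact mul_le_of_le_one_right (gapCoeff_pos k).le
    (pow_le_one₀ (abs_nonneg _) (abs_le.2 ⟨hu.1, hu.2⟩))

/-- Summability of the coefficients makes the series continuous on the closed interval, so the
identity extends to the endpoints. The value at `u = 1` gives `∑ c_k = log 2`. -/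
theorem hasSum_entropyGap {u : ℝ} (hu : u ∈ Icc (-1 : ℝ) 1) :
    HasSum (fun k => gapCoeff k * u ^ (2 * k + 2)) (entropyGap u) := by
  have hs : ∀ v ∈ Icc (-1 : ℝ) 1, Summable fun k => gapCoeff k * v ^ (2 * k + 2) :=
    fun v hv => Summable.of_norm_bounded summable_gapCoeff (norm_gapCoeff_mul_pow_le hv)
  have hcont : ContinuousOn (fun v : ℝ => ∑' k, gapCoeff k * v ^ (2 * k + 2)) (Icc (-1) 1) :=
    continuousOn_tsum (fun k => by fun_prop) summable_gapCoeff
      fun k v hv => norm_gapCoeff_mul_pow_le hv k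
  have heq : EqOn (fun v : ℝ => ∑' k, gapCoeff k * v ^ (2 * k + 2)) entropyGap (Ioo (-1) 1) :=
    fun v hv => (hasSum_entropyGap_of_abs_lt_one (abs_lt.2 hv)).tsum_eq
  have := heq.of_subset_closure hcont continuous_entropyGap.continuousOn Ioo_subset_Icc_self
    (by rw [closure_Ioo (by norm_num)])
  exact (hs u hu).hasSum_iff.2 (this hu)

theorem entropyGap_one : entropyGap 1 = Real.log 2 := by
  unfold entropyGap
  norm_num [Real.negMulLog]

theorem hasSum_gapCoeff : HasSum gapCoeff (Real.log 2) := by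
  simpa [entropyGap_one] using hasSum_entropyGap (u := 1) (by simp)

/-- Integrated form of the series, with a weight. -/
theorem hasSum_integral_mul_pow {Ω : Type*} [MeasurableSpace Ω] {μ : Measure Ω}
    [IsFiniteMeasure μ] {A U : Ω → ℝ} (hA : Integrable A μ) (hU : Measurable U)
    (hU1 : ∀ ω, U ω ∈ Icc (-1 : ℝ) 1) :
    HasSum (fun k => gapCoeff k * ∫ ω, A ω * U ω ^ (2 * k + 2) ∂μ)
      (∫ ω, A ω * entropyGap (U ω) ∂μ) := by
  have h := hasSum_integral_of_dominated_convergence (μ := μ)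
    (F := fun k ω => A ω * (gapCoeff k * U ω ^ (2 * k + 2)))
    (f := fun ω => A ω * entropyGap (U ω)) (bound := fun k ω => |A ω| * gapCoeff k)
    (fun k => hA.aestronglyMeasurable.mul
      ((hU.pow_const _).const_mul _).aestronglyMeasurable)
    (fun k => Eventually.of_forall fun ω => by
      rw [norm_mul, Real.norm_eq_abs]
      exact mul_le_mul_of_nonneg_left (norm_gapCoeff_mul_pow_le (hU1 ω) k) (abs_nonneg _))
    (Eventually.of_forall fun ω => summable_gapCoeff.mul_left _)
    (by simp_rw [tsum_mul_left]; exact hA.abs.mul_const _)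
    (Eventually.of_forall fun ω => (hasSum_entropyGap (hU1 ω)).mul_left _)
  refine h.congr_fun fun k => ?_
  rw [← integral_const_mul]
  congr 1; ext ω; ring

/-! ### Posterior means and entropies of finite inputs -/

theorem integrable_of_abs_le {Ω : Type*} [MeasurableSpace Ω] {μ : Measure Ω} [IsFiniteMeasure μ]
    {c : Ω → ℝ} (hc : Measurable c) {C : ℝ} (h : ∀ ω, |c ω| ≤ C) : Integrable c μ :=
  Integrable.of_bound hc.aestronglyMeasurable C (Eventually.of_forall h)

section Posterior

variable {α β γ : Type*} [Fintype α] [MeasurableSpace α] [MeasurableSpace β] [MeasurableSpace γ]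

/-- The expectation of `F` of the input and of the output, when a finite input with law `p`
passes through the channel `K`. -/
def expect (p : Measure α) (K : Kernel α β) (F : α → β → ℝ) : ℝ :=
  ∑ x, p.real {x} * ∫ y, F x y ∂(K x)

theorem integral_compProd_eq_expect [MeasurableSingletonClass α] (p : Measure α) [IsFiniteMeasure p] (K : Kernel α β)
    [IsMarkovKernel K] {F : α → β → ℝ} (hF : ∀ x, Measurable (F x)) {C : ℝ}
    (hC : ∀ x y, |F x y| ≤ C) :
    ∫ ω, F ω.1 ω.2 ∂(p ⊗ₘ K) = expect p K F := by
  have hm : Measurable fun ω : α × β => F ω.1 ω.2 :=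
    measurable_from_prod_countable_right hF
  rw [Measure.integral_compProd (integrable_of_abs_le hm fun ω => hC _ _), integral_fintype .of_finite]
  rfl

theorem integral_comp_eq_expect [MeasurableSingletonClass α] {Ω : Type*} [MeasurableSpace Ω] {μ : Measure Ω} {X : Ω → α}
    {Y : Ω → β} (hX : Measurable X) (hY : Measurable Y) {p : Measure α} [IsFiniteMeasure p]
    {K : Kernel α β} [IsMarkovKernel K] (hXY : μ.map (fun ω => (X ω, Y ω)) = p ⊗ₘ K)
    {F : α → β → ℝ} (hF : ∀ x, Measurable (F x)) {C : ℝ} (hC : ∀ x y, |F x y| ≤ C) :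
    ∫ ω, F (X ω) (Y ω) ∂μ = expect p K F := by
  have hm : Measurable fun ω : α × β => F ω.1 ω.2 :=
    measurable_from_prod_countable_right hF
  rw [← integral_compProd_eq_expect p K hF hC, ← hXY,
    integral_map (hX.prodMk hY).aemeasurable hm.aestronglyMeasurable]

/-- `z` is a version, with values in `[-1, 1]`, of the conditional mean of `f` of the input
given the output. -/
structure IsPosteriorMean (p : Measure α) (K : Kernel α β) (f : α → ℝ) (z : β → ℝ) : Prop where
  measurable : Measurable z
  abs_le_one : ∀ y, |z y| ≤ 1
  expect_eq : ∀ c : β → ℝ, Measurable c → (∃ C, ∀ y, |c y| ≤ C) →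
    expect p K (fun x y => f x * c y) = expect p K (fun _ y => z y * c y)

variable {p : Measure α} {K : Kernel α β} {f : α → ℝ} {z : β → ℝ}

theorem IsPosteriorMean.condExp_ae_eq [MeasurableSingletonClass α] [IsFiniteMeasure p]
    [IsMarkovKernel K] (hz : IsPosteriorMean p K f z) (hf : ∀ x, |f x| ≤ 1)
    {Ω : Type*} [MeasurableSpace Ω] {μ : Measure Ω} [IsFiniteMeasure μ] {X : Ω → α}
    {Y : Ω → β} (hX : Measurable X) (hY : Measurable Y)
    (hXY : μ.map (fun ω => (X ω, Y ω)) = p ⊗ₘ K) :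
    μ[fun ω => f (X ω) | MeasurableSpace.comap Y inferInstance] =ᵐ[μ] fun ω => z (Y ω) := by
  have hfX : Measurable fun ω => f (X ω) := (measurable_of_countable f).comp hX
  have hzY : Measurable fun ω => z (Y ω) := hz.measurable.comp hY
  symm
  refine ae_eq_condExp_of_forall_setIntegral_eq hY.comap_le
    (integrable_of_abs_le hfX fun ω => hf _)
    (fun s _ _ => (integrable_of_abs_le hzY fun ω => hz.abs_le_one _).integrableOn) ?_ ?_
  · rintro s ⟨S, hS, rfl⟩ -
    have hc : Measurable (S.indicator (1 : β → ℝ)) := measurable_one.indicator hS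
    have hc1 : ∀ y, |S.indicator (1 : β → ℝ) y| ≤ 1 := fun y => by
      by_cases hy : y ∈ S <;> simp [hy]
    have h := hz.expect_eq _ hc ⟨1, hc1⟩
    have hind : ∀ h : Ω → ℝ, ∫ ω in Y ⁻¹' S, h ω ∂μ =
        ∫ ω, h ω * S.indicator (1 : β → ℝ) (Y ω) ∂μ := fun h => by
      rw [← integral_indicator (hY hS)]
      congr 1; ext ω
      by_cases hω : Y ω ∈ S <;> simp [hω]
    rw [hind, hind,
      integral_comp_eq_expect hX hY hXY (F := fun _ y => z y * S.indicator (1 : β → ℝ) y)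
        (C := 1) (fun _ => hz.measurable.mul hc)
        (fun _ y => by
          rw [abs_mul]; exact mul_le_one₀ (hz.abs_le_one y) (abs_nonneg _) (hc1 y)),
      integral_comp_eq_expect hX hY hXY (F := fun x y => f x * S.indicator (1 : β → ℝ) y)
        (C := 1) (fun _ => hc.const_mul _)
        (fun x y => by rw [abs_mul]; exact mul_le_one₀ (hf x) (abs_nonneg _) (hc1 y)), h]
  · exact (hz.measurable.stronglyMeasurable.comp_measurable
      (comap_measurable Y)).aestronglyMeasurable

theorem expect_add {F G : α → β → ℝ} (hF : ∀ x, Integrable (F x) (K x))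
    (hG : ∀ x, Integrable (G x) (K x)) :
    expect p K (fun x y => F x y + G x y) = expect p K F + expect p K G := by
  unfold expect
  rw [← Finset.sum_add_distrib]
  refine Finset.sum_congr rfl fun x _ => ?_
  rw [integral_add (hF x) (hG x), mul_add]

theorem expect_const_mul (a : ℝ) (F : α → β → ℝ) :
    expect p K (fun x y => a * F x y) = a * expect p K F := by
  unfold expect
  rw [Finset.mul_sum]
  refine Finset.sum_congr rfl fun x _ => ?_
  rw [integral_const_mul]; ring

theorem expect_const [MeasurableSingletonClass α] [IsProbabilityMeasure p] [IsMarkovKernel K]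
    (a : ℝ) : expect p K (fun _ _ => a) = a := by
  unfold expect
  simp [← Finset.sum_mul]

theorem expect_mono {F G : α → β → ℝ} (hF : ∀ x, Integrable (F x) (K x))
    (hG : ∀ x, Integrable (G x) (K x)) (h : ∀ x y, F x y ≤ G x y) :
    expect p K F ≤ expect p K G :=
  Finset.sum_le_sum fun x _ => mul_le_mul_of_nonneg_left
    (integral_mono (hF x) (hG x) (h x)) measureReal_nonneg

/-- The even moments of a posterior mean. -/
def moment (p : Measure α) (K : Kernel α β) (z : β → ℝ) (k : ℕ) : ℝ :=
  expect p K fun _ y => z y ^ (2 * k + 2)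

theorem IsPosteriorMean.integrable_pow [IsMarkovKernel K] (hz : IsPosteriorMean p K f z) (x : α) (k : ℕ) :
    Integrable (fun y => z y ^ k) (K x) :=
  integrable_of_abs_le (hz.measurable.pow_const k) (C := 1) fun y => by
    rw [abs_pow]; exact pow_le_one₀ (abs_nonneg _) (hz.abs_le_one y)

theorem moment_nonneg (k : ℕ) : 0 ≤ moment p K z k :=
  Finset.sum_nonneg fun x _ => mul_nonneg measureReal_nonneg
    (integral_nonneg fun y => Even.pow_nonneg ⟨k + 1, by ring⟩ _)

theorem IsPosteriorMean.moment_le_moment_zero [IsMarkovKernel K]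
    (hz : IsPosteriorMean p K f z) (k : ℕ) :
    moment p K z k ≤ moment p K z 0 := by
  refine expect_mono (fun x => hz.integrable_pow x _) (fun x => hz.integrable_pow x _)
    fun _ y => ?_
  have h1 : 0 ≤ z y ^ 2 := sq_nonneg _
  have h2 : z y ^ 2 ≤ 1 := (sq_le_one_iff_abs_le_one _).2 (hz.abs_le_one y)
  calc z y ^ (2 * k + 2) = (z y ^ 2) ^ k * z y ^ 2 := by ring
    _ ≤ 1 * z y ^ 2 := mul_le_mul_of_nonneg_right (pow_le_one₀ h1 h2) h1
    _ = z y ^ (2 * 0 + 2) := by ring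

theorem IsPosteriorMean.moment_le_one [MeasurableSingletonClass α] [IsProbabilityMeasure p]
    [IsMarkovKernel K] (hz : IsPosteriorMean p K f z) (k : ℕ) :
    moment p K z k ≤ 1 := by
  refine (hz.moment_le_moment_zero k).trans ?_
  rw [← expect_const (p := p) (K := K) 1]
  refine expect_mono (fun x => hz.integrable_pow x _) (fun x => integrable_const _)
    fun _ y => ?_
  exact (sq_le_one_iff_abs_le_one _).2 (hz.abs_le_one y)

/-- Bernoulli's inequality `1 + (k+1)(z² - 1) ≤ (z²)^(k+1)`, averaged over the output. It lets the
MMSE control every higher weight. -/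
theorem IsPosteriorMean.one_sub_moment_le [MeasurableSingletonClass α] [IsProbabilityMeasure p]
    [IsMarkovKernel K] (hz : IsPosteriorMean p K f z) (k : ℕ) :
    1 - moment p K z k ≤ (k + 1) * (1 - moment p K z 0) := by
  have h : expect p K (fun _ y => ((k : ℝ) + 1) * z y ^ (2 * 0 + 2)) ≤
      expect p K (fun _ y => z y ^ (2 * k + 2) + k) := by
    refine expect_mono (fun x => (hz.integrable_pow x _).const_mul _)
      (fun x => (hz.integrable_pow x _).add (integrable_const _)) fun _ y => ?_
    have := one_add_mul_sub_le_pow (a := z y ^ 2) (by nlinarith [sq_nonneg (z y)]) (k + 1)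
    push_cast at this
    have h2 : z y ^ (2 * k + 2) = (z y ^ 2) ^ (k + 1) := by rw [← pow_mul]; ring_nf
    rw [h2]; simp only [mul_zero, zero_add]; linarith
  rw [expect_const_mul, expect_add (fun x => hz.integrable_pow x _) (fun x => integrable_const _),
    expect_const] at h
  change ((k : ℝ) + 1) * moment p K z 0 ≤ moment p K z k + k at h
  linarith

/-- Orthogonality: `𝔼[f z] = 𝔼[z²]`. Index `0` of `moment` is the second moment. -/
theorem mmse_eq_one_sub_moment [MeasurableSingletonClass α] [IsProbabilityMeasure p]
    [IsMarkovKernel K] (hz : IsPosteriorMean p K f z) (hf : ∀ x, f x ^ 2 = 1)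
    {Ω : Type*} [MeasurableSpace Ω] {μ : Measure Ω} [IsFiniteMeasure μ] {X : Ω → α}
    {Y : Ω → β} (hX : Measurable X) (hY : Measurable Y)
    (hXY : μ.map (fun ω => (X ω, Y ω)) = p ⊗ₘ K) :
    mmse μ (fun ω => f (X ω)) Y = 1 - moment p K z 0 := by
  have hf1 : ∀ x, |f x| ≤ 1 := fun x => (sq_le_one_iff_abs_le_one _).1 (hf x).le
  have hint : ∀ x, Integrable (fun y => f x * z y) (K x) := fun x =>
    (by simpa using hz.integrable_pow x 1 : Integrable z (K x)).const_mul _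
  calc mmse μ (fun ω => f (X ω)) Y = ∫ ω, (f (X ω) - z (Y ω)) ^ 2 ∂μ := by
        refine integral_congr_ae ?_
        filter_upwards [hz.condExp_ae_eq hf1 hX hY hXY] with ω hω
        rw [hω]
    _ = expect p K (fun x y => (f x - z y) ^ 2) :=
        integral_comp_eq_expect hX hY hXY (F := fun x y => (f x - z y) ^ 2) (C := 4)
          (fun x => (hz.measurable.const_sub _).pow_const 2) fun x y => by
            obtain ⟨h1, h2⟩ := abs_le.1 (hf1 x)
            obtain ⟨h3, h4⟩ := abs_le.1 (hz.abs_le_one y)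
            rw [abs_of_nonneg (sq_nonneg _)]
            nlinarith
    _ = expect p K (fun x y => 1 + ((-2) * (f x * z y) + z y ^ 2)) := by
        congr 1; ext x y; rw [sub_sq, hf]; ring
    _ = 1 - moment p K z 0 := by
        have h1 : ∀ x, Integrable (fun y => -2 * (f x * z y) + z y ^ 2) (K x) := fun x =>
          ((hint x).const_mul _).add (hz.integrable_pow x 2)
        rw [expect_add (fun x => integrable_const _) h1, expect_add
          (fun x => (hint x).const_mul _) (fun x => hz.integrable_pow x 2), expect_const,
          expect_const_mul, hz.expect_eq z hz.measurable ⟨1, hz.abs_le_one⟩]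
        simp only [← sq, moment]; ring

/-- A convex function lies above its tangent at `u`. Since the tangent is affine in `z`, it can be
averaged using only the defining property of posterior means, in place of conditional Jensen. -/
theorem pow_even_tangent_le (z u : ℝ) (k : ℕ) :
    u ^ (2 * k + 2) + (2 * k + 2) * u ^ (2 * k + 1) * (z - u) ≤ z ^ (2 * k + 2) := by
  have hconv : ConvexOn ℝ univ fun x : ℝ => x ^ (2 * k + 2) := Even.convexOn_pow ⟨k + 1, by ring⟩
  have hd : HasDerivAt (fun x : ℝ => x ^ (2 * k + 2)) ((2 * k + 2) * u ^ (2 * k + 1)) u := by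
    simpa using hasDerivAt_pow (2 * k + 2) u
  rcases lt_trichotomy u z with h | h | h
  · have := hconv.le_slope_of_hasDerivAt (mem_univ u) (mem_univ z) h hd
    rw [slope_def_field, le_div_iff₀ (sub_pos.2 h)] at this
    linarith
  · subst h; simp
  · have := hconv.slope_le_of_hasDerivAt (mem_univ z) (mem_univ u) h hd
    rw [slope_def_field, div_le_iff₀ (sub_pos.2 h)] at this
    linarith

/-- Degrading the channel lowers the even moments of the posterior mean. -/
theorem IsPosteriorMean.moment_comp_le [IsMarkovKernel K] (hz : IsPosteriorMean p K f z)
    {κ : Kernel β γ} [IsMarkovKernel κ] {u : γ → ℝ} (hu : IsPosteriorMean p (κ ∘ₖ K) f u) (k : ℕ) :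
    moment p (κ ∘ₖ K) u k ≤ moment p K z k := by
  -- `c` is the slope of the tangent to `x^(2k+2)` at `u`, and `d` below is its intercept `u^(2k+2)
  -- - u c`. In the average of `d + u c`, the factor `u` is replaced by `f` (posterior mean after
  -- degradation) and then by `z` (posterior mean before it), where the tangent bound applies.
  set c : γ → ℝ := fun y => (2 * k + 2) * u y ^ (2 * k + 1) with hc
  have hcm : Measurable c := (hu.measurable.pow_const _).const_mul _
  have hcb : ∀ y, |c y| ≤ 2 * k + 2 := fun y => by
    have h0 : (0 : ℝ) ≤ 2 * k + 2 := by positivity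
    rw [hc, abs_mul, abs_of_nonneg h0, abs_pow]
    exact mul_le_of_le_one_right h0 (pow_le_one₀ (abs_nonneg _) (hu.abs_le_one y))
  have hub : ∀ (j : ℕ) (y : γ), |u y ^ j| ≤ 1 := fun j y => by
    rw [abs_pow]; exact pow_le_one₀ (abs_nonneg _) (hu.abs_le_one y)
  have hci : ∀ (ν : Measure γ) [IsFiniteMeasure ν], Integrable c ν :=
    fun ν _ => integrable_of_abs_le hcm hcb
  have hui : ∀ (ν : Measure γ) [IsFiniteMeasure ν] (j : ℕ), Integrable (fun y => u y ^ j) ν :=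
    fun ν _ j => integrable_of_abs_le (hu.measurable.pow_const j) (hub j)
  set d : γ → ℝ := fun y => (-(2 * k + 1)) * u y ^ (2 * k + 2) with hd
  have hdi : ∀ (ν : Measure γ) [IsFiniteMeasure ν], Integrable d ν :=
    fun ν _ => (hui ν _).const_mul _
  have hdm : Measurable d := (hu.measurable.pow_const _).const_mul _
  have hdb : ∀ y, |d y| ≤ 2 * k + 1 := fun y => by
    have h0 : (0 : ℝ) ≤ 2 * k + 1 := by positivity
    rw [hd, abs_mul, abs_neg, abs_of_nonneg h0]
    exact mul_le_of_le_one_right h0 (hub _ y)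
  have havg : ∀ {g : γ → ℝ} {C : ℝ}, (∀ y, |g y| ≤ C) → ∀ y, |∫ y', g y' ∂(κ y)| ≤ C := by
    intro g C hC y
    have := norm_integral_le_of_norm_le_const (μ := κ y) (f := g) (C := C)
      (Eventually.of_forall hC)
    simpa using this
  have hCm : Measurable fun y => ∫ y', c y' ∂(κ y) :=
    (hcm.stronglyMeasurable.integral_kernel (κ := κ)).measurable
  have hDm : Measurable fun y => ∫ y', d y' ∂(κ y) :=
    (hdm.stronglyMeasurable.integral_kernel (κ := κ)).measurable
  have hCi : ∀ x, Integrable (fun y => ∫ y', c y' ∂(κ y)) (K x) := fun x =>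
    integrable_of_abs_le hCm (havg hcb)
  have hDi : ∀ x, Integrable (fun y => ∫ y', d y' ∂(κ y)) (K x) := fun x =>
    integrable_of_abs_le hDm (havg hdb)
  have hzCi : ∀ x, Integrable (fun y => z y * ∫ y', c y' ∂(κ y)) (K x) := fun x =>
    (hCi x).bdd_mul hz.measurable.aestronglyMeasurable (Eventually.of_forall hz.abs_le_one)
  calc moment p (κ ∘ₖ K) u k
      = expect p (κ ∘ₖ K) (fun x y => d y + u y * c y) := by
        unfold moment; congr 1; ext x y; simp only [hd, hc]; ring
    _ = expect p (κ ∘ₖ K) (fun x y => d y + f x * c y) := by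
        rw [expect_add (fun x => hdi _) (fun x => (hci _).bdd_mul hu.measurable.aestronglyMeasurable
          (Eventually.of_forall hu.abs_le_one)), ← hu.expect_eq c hcm ⟨_, hcb⟩,
          expect_add (fun x => hdi _) (fun x => (hci _).const_mul _)]
    _ = expect p K (fun x y => (∫ y', d y' ∂(κ y)) + f x * ∫ y', c y' ∂(κ y)) := by
        unfold expect
        refine Finset.sum_congr rfl fun x _ => ?_
        have h1 : Integrable (fun y => d y + f x * c y) ((κ ∘ₖ K) x) :=
          (hdi _).add ((hci _).const_mul _)
        rw [Kernel.integral_comp h1]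
        congr 2; ext y
        rw [integral_add (hdi _) ((hci _).const_mul _), integral_const_mul (f x)]
    _ = expect p K (fun x y => (∫ y', d y' ∂(κ y)) + z y * ∫ y', c y' ∂(κ y)) := by
        rw [expect_add hDi (fun x => (hCi x).const_mul _), hz.expect_eq _ hCm ⟨_, havg hcb⟩,
          ← expect_add hDi hzCi]
    _ ≤ moment p K z k := by
        refine expect_mono (fun x => (hDi x).add (hzCi x)) (fun x => hz.integrable_pow x _)
          fun x y => ?_
        rw [← integral_const_mul, ← integral_add (hdi _) ((hci _).const_mul _)]
        have : z y ^ (2 * k + 2) = ∫ _, z y ^ (2 * k + 2) ∂(κ y) := by simp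
        rw [this]
        refine integral_mono ((hdi _).add ((hci _).const_mul _)) (integrable_const _) fun y' => ?_
        have := pow_even_tangent_le (z y) (u y') k
        simp only [hd, hc]
        have h2 : u y' ^ (2 * k + 2) = u y' ^ (2 * k + 1) * u y' := by ring
        rw [h2] at this ⊢
        linarith

end Posterior

/-! ### Channels given by densities -/

section Density

variable {α β : Type*} [MeasurableSpace α] [MeasurableSpace β]

/-- The channel `K` has the bounded densities `k x` with respect to `m`. -/
structure HasDensity (K : Kernel α β) (m : Measure β) (k : α → β → ℝ) : Prop where
  measurable : ∀ x, Measurable (k x)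
  nonneg : ∀ x y, 0 ≤ k x y
  bounded : ∃ C, ∀ x y, k x y ≤ C
  eq_withDensity : ∀ x, K x = m.withDensity fun y => ENNReal.ofReal (k x y)

variable {p : Measure α} {K : Kernel α β} {m : Measure β} {k : α → β → ℝ}

theorem HasDensity.integral_eq (hK : HasDensity K m k) (x : α) (F : β → ℝ) :
    ∫ y, F y ∂(K x) = ∫ y, k x y * F y ∂m := by
  rw [hK.eq_withDensity, integral_withDensity_eq_integral_toReal_smul
    (hK.measurable x).ennreal_ofReal (by simp)]
  simp [ENNReal.toReal_ofReal (hK.nonneg _ _)]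

theorem HasDensity.integrable_mul [IsFiniteMeasure m] (hK : HasDensity K m k) (x : α) {F : β → ℝ}
    (hF : Integrable F m) : Integrable (fun y => k x y * F y) m := by
  obtain ⟨C, hC⟩ := hK.bounded
  exact hF.bdd_mul (hK.measurable x).aestronglyMeasurable
    (Eventually.of_forall fun y => by
      rw [Real.norm_of_nonneg (hK.nonneg x y)]; exact hC x y)

theorem HasDensity.weight_nonneg (hK : HasDensity K m k) (x : α) (y : β) :
    0 ≤ p.real {x} * k x y := mul_nonneg measureReal_nonneg (hK.nonneg x y)

variable [Fintype α]

/-- The density of the output when the input has law `p`. -/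
def evidence (p : Measure α) (k : α → β → ℝ) (y : β) : ℝ := ∑ x, p.real {x} * k x y

/-- The posterior mean of `f` of the input, by Bayes' rule. -/
def posterior (p : Measure α) (k : α → β → ℝ) (f : α → ℝ) (y : β) : ℝ :=
  (∑ x, p.real {x} * k x y * f x) / evidence p k y

theorem HasDensity.evidence_nonneg (hK : HasDensity K m k) (y : β) : 0 ≤ evidence p k y :=
  Finset.sum_nonneg fun x _ => hK.weight_nonneg x y

theorem HasDensity.weight_eq_zero (hK : HasDensity K m k) {y : β} (h : evidence p k y = 0)
    (x : α) : p.real {x} * k x y = 0 :=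
  (Finset.sum_eq_zero_iff_of_nonneg fun x _ => hK.weight_nonneg x y).1 h x (Finset.mem_univ x)

/-- Where the evidence vanishes so does every weight, so the default value of the division by zero
is harmless. -/
theorem HasDensity.evidence_mul_posterior (hK : HasDensity K m k) (f : α → ℝ) (y : β) :
    evidence p k y * posterior p k f y = ∑ x, p.real {x} * k x y * f x := by
  by_cases h : evidence p k y = 0
  · rw [h, zero_mul]
    exact (Finset.sum_eq_zero fun x _ => by rw [hK.weight_eq_zero h, zero_mul]).symm
  · exact mul_div_cancel₀ _ h

theorem HasDensity.measurable_evidence (hK : HasDensity K m k) : Measurable (evidence p k) :=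
  Finset.measurable_fun_sum _ fun x _ => (hK.measurable x).const_mul _

theorem HasDensity.evidence_bounded (hK : HasDensity K m k) :
    ∃ C, ∀ y, evidence p k y ≤ C := by
  obtain ⟨C, hC⟩ := hK.bounded
  exact ⟨∑ x : α, p.real {x} * C, fun y => Finset.sum_le_sum fun x _ =>
    mul_le_mul_of_nonneg_left (hC x y) measureReal_nonneg⟩

theorem HasDensity.measurable_posterior (hK : HasDensity K m k) (f : α → ℝ) :
    Measurable (posterior p k f) :=
  (Finset.measurable_fun_sum _ fun x _ => ((hK.measurable x).const_mul _).mul_const _).div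
    hK.measurable_evidence

theorem HasDensity.abs_posterior_le (hK : HasDensity K m k) {f : α → ℝ} (hf : ∀ x, |f x| ≤ 1)
    (y : β) : |posterior p k f y| ≤ 1 := by
  rw [posterior, abs_div, abs_of_nonneg (hK.evidence_nonneg y)]
  refine div_le_one_of_le₀ ((Finset.abs_sum_le_sum_abs _ _).trans
    (Finset.sum_le_sum fun x _ => ?_)) (hK.evidence_nonneg y)
  rw [abs_mul, abs_of_nonneg (hK.weight_nonneg x y)]
  exact mul_le_of_le_one_right (hK.weight_nonneg x y) (hf x)

theorem HasDensity.expect_eq [IsFiniteMeasure m] (hK : HasDensity K m k) {F : α → β → ℝ}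
    (hF : ∀ x, Integrable (F x) m) :
    expect p K F = ∫ y, ∑ x, p.real {x} * k x y * F x y ∂m := by
  simp_rw [mul_assoc]
  rw [integral_finsetSum _ fun x _ => (hK.integrable_mul x (hF x)).const_mul _]
  unfold expect
  simp_rw [integral_const_mul, hK.integral_eq]

theorem HasDensity.expect_output_eq [IsFiniteMeasure m] (hK : HasDensity K m k) {F : β → ℝ}
    (hF : Integrable F m) :
    expect p K (fun _ y => F y) = ∫ y, evidence p k y * F y ∂m := by
  rw [hK.expect_eq fun _ => hF]
  simp_rw [evidence, Finset.sum_mul]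

theorem HasDensity.isPosteriorMean [IsFiniteMeasure m] (hK : HasDensity K m k) {f : α → ℝ}
    (hf : ∀ x, |f x| ≤ 1) : IsPosteriorMean p K f (posterior p k f) where
  measurable := hK.measurable_posterior f
  abs_le_one := hK.abs_posterior_le hf
  expect_eq := by
    rintro c hc ⟨C, hC⟩
    have hci : Integrable c m := integrable_of_abs_le hc hC
    rw [hK.expect_eq fun x => hci.const_mul _, hK.expect_output_eq (hci.bdd_mul
      (hK.measurable_posterior f).aestronglyMeasurable
      (Eventually.of_forall (hK.abs_posterior_le hf)))]
    congr 1; ext y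
    rw [← mul_assoc, hK.evidence_mul_posterior, Finset.sum_mul]
    exact Finset.sum_congr rfl fun x _ => by ring

theorem HasDensity.integral_evidence [MeasurableSingletonClass α] [IsProbabilityMeasure p]
    [IsMarkovKernel K] [IsFiniteMeasure m] (hK : HasDensity K m k) :
    ∫ y, evidence p k y ∂m = 1 := by
  have := hK.expect_output_eq (p := p) (F := fun _ => 1) (integrable_const _)
  rw [expect_const] at this
  simpa using this.symm

/-- Pointwise chain rule: conditional entropy is joint entropy minus output entropy. The right side
contains no quotient and factors well over product channels. -/
theorem HasDensity.evidence_mul_sum_negMulLog (hK : HasDensity K m k) (y : β) :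
    evidence p k y * ∑ x, Real.negMulLog (p.real {x} * k x y / evidence p k y) =
      ∑ x, Real.negMulLog (p.real {x} * k x y) - Real.negMulLog (evidence p k y) := by
  by_cases h : evidence p k y = 0
  · rw [h]
    simp [hK.weight_eq_zero h]
  · have h1 : ∀ x, evidence p k y * Real.negMulLog (p.real {x} * k x y / evidence p k y) =
        Real.negMulLog (p.real {x} * k x y) +
          p.real {x} * k x y * Real.log (evidence p k y) := by
      intro x
      by_cases hx : p.real {x} * k x y = 0
      · simp [hx]
      · simp only [Real.negMulLog]
        rw [Real.log_div hx h]
        field_simp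
        ring
    rw [Finset.mul_sum]
    simp_rw [h1]
    rw [Finset.sum_add_distrib, ← Finset.sum_mul]
    simp only [Real.negMulLog]
    rw [← evidence]
    ring

theorem HasDensity.condEntropy_eq [MeasurableSingletonClass α] [IsProbabilityMeasure p]
    [IsMarkovKernel K] [IsFiniteMeasure m] (hK : HasDensity K m k)
    {Ω : Type*} [MeasurableSpace Ω] {μ : Measure Ω} [IsFiniteMeasure μ] {X : Ω → α}
    {Y : Ω → β} (hX : Measurable X) (hY : Measurable Y)
    (hXY : μ.map (fun ω => (X ω, Y ω)) = p ⊗ₘ K) :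
    condEntropy μ X Y = (∫ y, (∑ x, Real.negMulLog (p.real {x} * k x y) -
      Real.negMulLog (evidence p k y)) ∂m) / Real.log 2 := by
  classical
  unfold condEntropy
  congr 1
  -- Posterior probabilities are posterior means of indicators.
  have hpost : ∀ x, posterior p k (fun x' => if x' = x then 1 else 0) =
      fun y => p.real {x} * k x y / evidence p k y := fun x => by
    ext y; simp [posterior]
  have hae : ∀ᵐ ω ∂μ, ∀ x, (μ⟦X ⁻¹' {x} | MeasurableSpace.comap Y inferInstance⟧) ω =
      p.real {x} * k x (Y ω) / evidence p k (Y ω) := by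
    refine ae_all_iff.2 fun x => ?_
    have h := (hK.isPosteriorMean (p := p) (f := fun x' => if x' = x then 1 else 0) fun x' => by
      split_ifs <;> simp).condExp_ae_eq (fun x' => by split_ifs <;> simp) hX hY hXY
    have h1 : (X ⁻¹' {x}).indicator (fun _ => (1 : ℝ)) =
        fun ω => if X ω = x then (1 : ℝ) else 0 := by
      ext ω; simp [indicator_apply]
    rw [h1]
    filter_upwards [h] with ω hω
    rw [hω, hpost]
  have hm : Measurable fun y => ∑ x, Real.negMulLog (p.real {x} * k x y / evidence p k y) :=
    Finset.measurable_fun_sum _ fun x _ => Real.continuous_negMulLog.measurable.comp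
      (((hK.measurable x).const_mul _).div hK.measurable_evidence)
  have hb : ∀ y, |∑ x, Real.negMulLog (p.real {x} * k x y / evidence p k y)| ≤
      ∑ _x : α, (1 : ℝ) := fun y => by
    refine (Finset.abs_sum_le_sum_abs _ _).trans (Finset.sum_le_sum fun x _ => ?_)
    have h0 : 0 ≤ p.real {x} * k x y / evidence p k y :=
      div_nonneg (hK.weight_nonneg x y) (hK.evidence_nonneg y)
    have h1 : p.real {x} * k x y / evidence p k y ≤ 1 := div_le_one_of_le₀
      (Finset.single_le_sum (f := fun x => p.real {x} * k x y)
        (fun x _ => hK.weight_nonneg x y) (Finset.mem_univ x)) (hK.evidence_nonneg y)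
    rw [abs_of_nonneg (Real.negMulLog_nonneg h0 h1)]
    linarith [Real.negMulLog_le_one_sub_self h0]
  calc _ = ∫ ω, ∑ x, Real.negMulLog (p.real {x} * k x (Y ω) / evidence p k (Y ω)) ∂μ := by
        refine integral_congr_ae ?_
        filter_upwards [hae] with ω hω
        simp_rw [hω]
    _ = expect p K (fun _ y => ∑ x, Real.negMulLog (p.real {x} * k x y / evidence p k y)) :=
        integral_comp_eq_expect hX hY hXY (F := fun _ y =>
          ∑ x, Real.negMulLog (p.real {x} * k x y / evidence p k y)) (fun _ => hm) fun _ => hb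
    _ = _ := by
        rw [hK.expect_output_eq (integrable_of_abs_le hm hb)]
        simp_rw [hK.evidence_mul_sum_negMulLog]

end Density

/-! ### Symmetric binary channels -/

/-- The sign of a binary input as a real number. -/
def sgn (x : ℤˣ) : ℝ := ((x : ℤ) : ℝ)

theorem sgn_sq (x : ℤˣ) : sgn x ^ 2 = 1 := by
  rcases Int.units_eq_one_or x with rfl | rfl <;> simp [sgn]

theorem abs_sgn (x : ℤˣ) : |sgn x| = 1 := by
  rcases Int.units_eq_one_or x with rfl | rfl <;> simp [sgn]

/-- A representation of a symmetric binary channel: the input `x` has the output density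
`1 + x D`, with respect to a symmetric probability measure, for an odd function `D`. -/
structure IsSymmetricDensity (K : Kernel ℤˣ EReal) (m : Measure EReal) (D : EReal → ℝ) : Prop where
  isProbabilityMeasure : IsProbabilityMeasure m
  measurable : Measurable D
  abs_le_one : ∀ y, |D y| ≤ 1
  neg_preserving : MeasurePreserving (fun y => -y) m m
  odd : ∀ y, D (-y) = -D y
  eq_withDensity : ∀ x, K x = m.withDensity fun y => ENNReal.ofReal (1 + sgn x * D y)

theorem measurable_ereal_neg : Measurable fun y : EReal => -y := continuous_neg.measurable

theorem eq_withDensity_of_measureReal_eq {β : Type*} [MeasurableSpace β] {ν m : Measure β}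
    [IsFiniteMeasure ν] {h : β → ℝ} (h0 : ∀ y, 0 ≤ h y) (hi : Integrable h m)
    (H : ∀ S, MeasurableSet S → ν.real S = ∫ y in S, h y ∂m) :
    ν = m.withDensity fun y => ENNReal.ofReal (h y) := by
  ext S hS
  rw [withDensity_apply _ hS, ← ofReal_integral_eq_lintegral_ofReal hi.integrableOn
    (Eventually.of_forall h0), ← H S hS, ofReal_measureReal]

/-- The reference measure is the average `m` of the two output laws `P` and `Q`. As `P ≤ 2m`, `P`
has a density `1 + d` with `|d| ≤ 1`, and then `Q = 2m - P` has density `1 - d`. -/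
theorem exists_isSymmetricDensity (K : Kernel ℤˣ EReal) [IsMarkovKernel K] (hK : IsSymmetric K) :
    ∃ m D, IsSymmetricDensity K m D := by
  set P := K 1 with hP
  set Q := K (-1) with hQ
  have hPQ : Q = P.map (fun y => -y) := hK
  have hQP : P = Q.map (fun y => -y) := by
    rw [hPQ, Measure.map_map measurable_ereal_neg measurable_ereal_neg]
    have : (fun y : EReal => -y) ∘ (fun y : EReal => -y) = id := by ext y; simp
    rw [this, Measure.map_id]
  set m : Measure EReal := (2⁻¹ : NNReal) • (P + Q) with hm
  have hmS : ∀ S, m.real S = (P.real S + Q.real S) / 2 := fun S => by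
    rw [hm, measureReal_nnreal_smul_apply, measureReal_add_apply]
    simp; ring
  have hprob : IsProbabilityMeasure m := by
    have h := hmS univ
    simp only [probReal_univ] at h
    refine ⟨?_⟩
    rw [← ENNReal.ofReal_one, ← ofReal_measureReal, h]
    norm_num
  have hneg : MeasurePreserving (fun y : EReal => -y) m m := by
    refine ⟨measurable_ereal_neg, ?_⟩
    rw [hm, Measure.map_smul, Measure.map_add _ _ measurable_ereal_neg, ← hPQ, ← hQP, add_comm]
  have hle : P ≤ (2 : ENNReal) • m := by
    refine Measure.le_iff.2 fun S _ => ?_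
    rw [Measure.smul_apply, ← ofReal_measureReal, ← ofReal_measureReal (μ := m), hmS, smul_eq_mul,
      ← ENNReal.ofReal_ofNat 2, ← ENNReal.ofReal_mul (by norm_num)]
    refine ENNReal.ofReal_le_ofReal ?_
    linarith [measureReal_nonneg (μ := Q) (s := S)]
  have hac : P ≪ m := (Measure.absolutelyContinuous_of_le hle).trans
    (Measure.smul_absolutelyContinuous)
  set ρ := P.rnDeriv m with hρ
  have hρm : Measurable ρ := Measure.measurable_rnDeriv P m
  have hPρ : m.withDensity ρ = P := Measure.withDensity_rnDeriv_eq P m hac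
  have hρ2 : ∀ᵐ y ∂m, ρ y ≤ 2 := by
    refine ae_le_of_forall_setLIntegral_le_of_sigmaFinite hρm fun S hS _ => ?_
    rw [← withDensity_apply _ hS, hPρ, setLIntegral_const]
    exact hle S
  -- Truncation at `2` changes the density on a null set only and makes `|d| ≤ 1` hold everywhere.
  set d : EReal → ℝ := fun y => (min (ρ y) 2).toReal - 1 with hd
  have hdm : Measurable d := ((hρm.min measurable_const).ennreal_toReal).sub_const 1
  have hd1 : ∀ y, |d y| ≤ 1 := fun y => by
    have h1 : (min (ρ y) 2).toReal ≤ 2 := by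
      simpa using ENNReal.toReal_mono (by simp) (min_le_right (ρ y) 2)
    rw [abs_le]
    constructor <;> simp only [hd] <;> linarith [ENNReal.toReal_nonneg (a := min (ρ y) 2)]
  have hdi : Integrable d m := integrable_of_abs_le hdm hd1
  have hP1 : ∀ S, MeasurableSet S → P.real S = ∫ y in S, (1 + d y) ∂m := fun S hS => by
    rw [measureReal_def, ← hPρ, withDensity_apply _ hS,
      integral_eq_lintegral_of_nonneg_ae
        (Eventually.of_forall fun y => by simp only [hd]; simp)
        ((hdm.const_add 1).aestronglyMeasurable)]
    congr 1
    refine lintegral_congr_ae (ae_restrict_of_ae ?_)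
    filter_upwards [hρ2] with y hy
    simp only [hd]
    rw [min_eq_left hy, add_sub_cancel, ENNReal.ofReal_toReal (ne_top_of_le_ne_top (by simp) hy)]
  have hQ1 : ∀ {h : EReal → ℝ}, Integrable h m →
      (∀ S, MeasurableSet S → P.real S = ∫ y in S, (1 + h y) ∂m) →
      ∀ S, MeasurableSet S → Q.real S = ∫ y in S, (1 - h y) ∂m := by
    intro h hh H S hS
    have h1 := H S hS
    rw [integral_add (integrable_const _) hh.integrableOn] at h1
    rw [integral_sub (integrable_const _) hh.integrableOn]
    have h2 := hmS S
    simp only [integral_const, measureReal_restrict_apply_univ, smul_eq_mul, mul_one] at h1 ⊢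
    linarith
  have hemb : MeasurableEmbedding fun y : EReal => -y :=
    (Homeomorph.neg EReal).measurableEmbedding
  have hdni : Integrable (fun y => d (-y)) m :=
    integrable_of_abs_le (hdm.comp measurable_ereal_neg) fun y => hd1 _
  have hP2 : ∀ S, MeasurableSet S → P.real S = ∫ y in S, (1 - d (-y)) ∂m := fun S hS => by
    have h1 := hQ1 hdi hP1 _ (measurable_ereal_neg hS)
    rw [← hneg.setIntegral_preimage_emb hemb (fun y => 1 - d y)] at h1
    have h2 : (fun y : EReal => -y) ⁻¹' ((fun y : EReal => -y) ⁻¹' S) = S := by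
      ext y; simp
    rw [h2] at h1
    rw [← h1]
    conv_lhs => rw [hQP]
    rw [map_measureReal_apply measurable_ereal_neg hS]
  -- By symmetry `1 + d y` and `1 - d (-y)` are both densities of `P`; their average has the form `1
  -- + D` with `D` odd at every point.
  set D : EReal → ℝ := fun y => (d y - d (-y)) / 2 with hD
  have hDi : Integrable D m := (hdi.sub hdni).div_const 2
  have hD1 : ∀ y, |D y| ≤ 1 := fun y => by
    obtain ⟨h1, h2⟩ := abs_le.1 (hd1 y)
    obtain ⟨h3, h4⟩ := abs_le.1 (hd1 (-y))
    rw [abs_le]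
    constructor <;> simp only [hD] <;> linarith
  have hPD : ∀ S, MeasurableSet S → P.real S = ∫ y in S, (1 + D y) ∂m := fun S hS => by
    have h1 := hP1 S hS
    have h2 := hP2 S hS
    rw [integral_add (integrable_const _) hdi.integrableOn] at h1
    rw [integral_sub (integrable_const _) hdni.integrableOn] at h2
    rw [integral_add (integrable_const _) hDi.integrableOn]
    simp only [hD]
    rw [integral_div, integral_sub hdi.integrableOn hdni.integrableOn]
    linarith
  have hQD := hQ1 hDi hPD
  refine ⟨m, D, hprob, (hdm.sub (hdm.comp measurable_ereal_neg)).div_const 2, hD1, hneg,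
    fun y => by simp only [hD, neg_neg]; ring, fun x => ?_⟩
  have hb := fun y => abs_le.1 (hD1 y)
  rcases Int.units_eq_one_or x with rfl | rfl
  · refine eq_withDensity_of_measureReal_eq (fun y => ?_)
      ((integrable_const _).add (hDi.const_mul _)) fun S hS => ?_
    · simp only [sgn, Units.val_one, Int.cast_one, one_mul]; linarith [(hb y).1]
    · simpa [sgn] using hPD S hS
  · refine eq_withDensity_of_measureReal_eq (fun y => ?_)
      ((integrable_const _).add (hDi.const_mul _)) fun S hS => ?_
    · simp [sgn]; linarith [(hb y).2]
    · simpa [sgn, sub_eq_add_neg] using hQD S hS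

section SymmetricDensity

variable {K : Kernel ℤˣ EReal} {m : Measure EReal} {D : EReal → ℝ}

theorem IsSymmetricDensity.hasDensity (h : IsSymmetricDensity K m D) :
    HasDensity K m (fun x y => 1 + sgn x * D y) where
  measurable x := (h.measurable.const_mul _).const_add _
  nonneg x y := by
    have : |sgn x * D y| ≤ 1 := by rw [abs_mul, abs_sgn, one_mul]; exact h.abs_le_one y
    linarith [(abs_le.1 this).1]
  bounded := ⟨2, fun x y => by
    have : |sgn x * D y| ≤ 1 := by rw [abs_mul, abs_sgn, one_mul]; exact h.abs_le_one y
    linarith [(abs_le.1 this).2]⟩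
  eq_withDensity := h.eq_withDensity

theorem IsSymmetricDensity.mem_Icc (h : IsSymmetricDensity K m D) (y : EReal) :
    D y ∈ Icc (-1 : ℝ) 1 := abs_le.1 (h.abs_le_one y)

theorem IsSymmetricDensity.integrable (h : IsSymmetricDensity K m D) : Integrable D m :=
  haveI := h.isProbabilityMeasure
  integrable_of_abs_le h.measurable h.abs_le_one

/-- The law of `D` is symmetric. -/
theorem IsSymmetricDensity.integral_neg_eq (h : IsSymmetricDensity K m D) (F : ℝ → ℝ) :
    ∫ y, F (-D y) ∂m = ∫ y, F (D y) ∂m := by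
  have := h.neg_preserving.integral_comp (Homeomorph.neg EReal).measurableEmbedding
    (fun y => F (D y))
  simpa [h.odd] using this

theorem IsSymmetricDensity.integral_eq_zero (h : IsSymmetricDensity K m D) :
    ∫ y, D y ∂m = 0 := by
  have := h.integral_neg_eq id
  simp only [id, integral_neg] at this
  linarith

theorem IsSymmetricDensity.integrable_negMulLog (h : IsSymmetricDensity K m D) {z : ℝ}
    (hz : |z| ≤ 1) : Integrable (fun y => Real.negMulLog (1 + z * D y)) m := by
  have := h.isProbabilityMeasure
  obtain ⟨C, hC⟩ := (isCompact_Icc (a := (0 : ℝ)) (b := 2)).exists_bound_of_continuousOn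
    Real.continuous_negMulLog.continuousOn
  refine integrable_of_abs_le (Real.continuous_negMulLog.measurable.comp
    ((h.measurable.const_mul _).const_add _)) (C := C) fun y => hC _ ?_
  have : |z * D y| ≤ 1 := by
    rw [abs_mul]; exact mul_le_one₀ hz (abs_nonneg _) (h.abs_le_one y)
  obtain ⟨h1, h2⟩ := abs_le.1 this
  exact ⟨by linarith, by linarith⟩

/-- Since `D` and `-D` have the same law, the integrand may be averaged over the sign of `D`, which
produces `-entropyGap`. -/
theorem IsSymmetricDensity.integral_negMulLog (h : IsSymmetricDensity K m D) {z : ℝ}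
    (hz : |z| ≤ 1) :
    ∫ y, Real.negMulLog (1 + z * D y) ∂m = -∫ y, entropyGap (z * D y) ∂m := by
  have h1 := h.integral_neg_eq fun u => Real.negMulLog (1 + z * u)
  have h2 := h.integrable_negMulLog hz
  have h3 := h.integrable_negMulLog (z := -z) (by rwa [abs_neg])
  simp only [mul_neg, ← sub_eq_add_neg, neg_mul] at h1 h3
  unfold entropyGap
  rw [integral_div, integral_neg, integral_add h2 h3, h1]
  ring

/-- The even moments of `D`. -/
def evenMoment (m : Measure EReal) (D : EReal → ℝ) (k : ℕ) : ℝ := ∫ y, D y ^ (2 * k + 2) ∂m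

theorem IsSymmetricDensity.hasSum_evenMoment (h : IsSymmetricDensity K m D) :
    HasSum (fun k => gapCoeff k * evenMoment m D k) (∫ y, entropyGap (D y) ∂m) := by
  have := h.isProbabilityMeasure
  simpa [evenMoment] using hasSum_integral_mul_pow (μ := m) (A := fun _ => 1) (U := D)
    (integrable_const _) h.measurable h.mem_Icc

end SymmetricDensity

/-! ### Uniform input: MMSE and entropy of a single channel. -/

theorem measureReal_uniform (x : ℤˣ) : (PMF.uniformOfFintype ℤˣ).toMeasure.real {x} = 1 / 2 := by
  rw [measureReal_def, PMF.toMeasure_apply_singleton _ _ (measurableSet_singleton x)]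
  simp

theorem sum_units {M : Type*} [AddCommMonoid M] (F : ℤˣ → M) : ∑ x, F x = F 1 + F (-1) := by
  rw [UnitsInt.univ, Finset.sum_pair (by decide)]

section Uniform

variable {K : Kernel ℤˣ EReal} {m : Measure EReal} {D : EReal → ℝ}

/-- The densities `1 + D` and `1 - D` average to `1`: under a uniform input, `m` is the output law
and `D` the posterior mean. -/
theorem evidence_uniform (y : EReal) :
    evidence (PMF.uniformOfFintype ℤˣ).toMeasure (fun x y => 1 + sgn x * D y) y = 1 := by
  simp only [evidence, measureReal_uniform, sum_units]
  simp [sgn]; ring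

theorem posterior_uniform :
    posterior (PMF.uniformOfFintype ℤˣ).toMeasure (fun x y => 1 + sgn x * D y) sgn = D := by
  ext y
  rw [posterior, evidence_uniform, div_one]
  simp only [measureReal_uniform, sum_units]
  simp [sgn]; ring

theorem IsSymmetricDensity.moment_uniform (h : IsSymmetricDensity K m D) (k : ℕ) :
    moment (PMF.uniformOfFintype ℤˣ).toMeasure K D k = evenMoment m D k := by
  have := h.isProbabilityMeasure
  rw [moment, h.hasDensity.expect_output_eq]
  · simp [evidence_uniform, evenMoment]
  · refine integrable_of_abs_le (h.measurable.pow_const _) (C := 1) fun y => ?_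
    rw [abs_pow]; exact pow_le_one₀ (abs_nonneg _) (h.abs_le_one y)

theorem IsSymmetricDensity.isPosteriorMean_uniform (h : IsSymmetricDensity K m D) :
    IsPosteriorMean (PMF.uniformOfFintype ℤˣ).toMeasure K sgn D := by
  have := h.isProbabilityMeasure
  have := h.hasDensity.isPosteriorMean (p := (PMF.uniformOfFintype ℤˣ).toMeasure)
    (f := sgn) fun x => (abs_sgn x).le
  rwa [posterior_uniform] at this

end Uniform

instance {W : ℝ → Kernel ℤˣ EReal} {t : ℝ} [IsMarkovKernel (W t)] :
    IsProbabilityMeasure (uniformLaw W t) := by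
  unfold uniformLaw; infer_instance

theorem mmseFun_eq {W : ℝ → Kernel ℤˣ EReal} {t : ℝ} [IsMarkovKernel (W t)] {m : Measure EReal}
    {D : EReal → ℝ} (h : IsSymmetricDensity (W t) m D) : mmseFun W t = 1 - evenMoment m D 0 := by
  rw [← h.moment_uniform]
  exact mmse_eq_one_sub_moment (X := Prod.fst) h.isPosteriorMean_uniform sgn_sq measurable_fst
    measurable_snd (by simp [uniformLaw])

theorem entropyFun_eq {W : ℝ → Kernel ℤˣ EReal} {t : ℝ} [IsMarkovKernel (W t)] {m : Measure EReal}
    {D : EReal → ℝ} (h : IsSymmetricDensity (W t) m D) :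
    entropyFun W t = (Real.log 2 - ∫ y, entropyGap (D y) ∂m) / Real.log 2 := by
  have := h.isProbabilityMeasure
  unfold entropyFun
  rw [h.hasDensity.condEntropy_eq (p := (PMF.uniformOfFintype ℤˣ).toMeasure) (X := Prod.fst)
    measurable_fst measurable_snd (by simp [uniformLaw])]
  congr 1
  have hpt : ∀ y, ∑ x : ℤˣ, Real.negMulLog ((PMF.uniformOfFintype ℤˣ).toMeasure.real {x} *
      (1 + sgn x * D y)) - Real.negMulLog (evidence (PMF.uniformOfFintype ℤˣ).toMeasure
        (fun x y => 1 + sgn x * D y) y) = Real.log 2 - entropyGap (D y) := fun y => by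
    rw [evidence_uniform, sum_units]
    simp only [measureReal_uniform, Real.negMulLog_mul]
    simp [sgn, entropyGap, Real.negMulLog]
    ring_nf
  simp_rw [hpt]
  rw [integral_sub (integrable_const _)]
  · simp
  · obtain ⟨C, hC⟩ := (isCompact_Icc (a := (-1 : ℝ)) (b := 1)).exists_bound_of_continuousOn
      continuous_entropyGap.continuousOn
    exact integrable_of_abs_le (continuous_entropyGap.measurable.comp h.measurable)
      fun y => hC _ (h.mem_Icc y)

/-! ### Memoryless channels -/

section Memoryless

variable {ι : Type*} [Fintype ι]

theorem hasDensity_memoryless {K : ι → Kernel ℤˣ EReal} [∀ j, IsMarkovKernel (K j)]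
    {m : ι → Measure EReal} [∀ j, IsProbabilityMeasure (m j)] {k : ι → ℤˣ → EReal → ℝ}
    (h : ∀ j, HasDensity (K j) (m j) (k j)) :
    HasDensity (memoryless K) (Measure.pi m) (fun x y => ∏ j, k j (x j) (y j)) where
  measurable x := Finset.measurable_fun_prod _ fun j _ =>
    ((h j).measurable _).comp (measurable_pi_apply j)
  nonneg x y := Finset.prod_nonneg fun j _ => (h j).nonneg _ _
  bounded := by
    choose C hC using fun j => (h j).bounded
    exact ⟨∏ j, C j, fun x y => Finset.prod_le_prod (fun j _ => (h j).nonneg _ _)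
      fun j _ => hC j _ _⟩
  eq_withDensity x := by
    have hint : ∀ j, Integrable (k j (x j)) (m j) := fun j => by
      simpa using (h j).integrable_mul (x j) (F := fun _ => 1) (integrable_const _)
    change Measure.pi (fun j => K j (x j)) = _
    refine Measure.pi_eq fun S hS => ?_
    have hprod : ∀ y : ι → EReal, (univ.pi S).indicator (fun y => ∏ j, k j (x j) (y j)) y =
        ∏ j, (S j).indicator (k j (x j)) (y j) := fun y => by
      by_cases hy : y ∈ univ.pi S
      · rw [indicator_of_mem hy]
        exact Finset.prod_congr rfl fun j _ => (indicator_of_mem (hy j (mem_univ j)) _).symm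
      · rw [indicator_of_notMem hy]
        obtain ⟨j, hj⟩ : ∃ j, y j ∉ S j := by simpa using hy
        exact (Finset.prod_eq_zero (Finset.mem_univ j) (indicator_of_notMem hj _)).symm
    have hSm : MeasurableSet (univ.pi S) := .univ_pi hS
    rw [withDensity_apply _ hSm, ← ofReal_integral_eq_lintegral_ofReal
      (Integrable.fintype_prod hint).integrableOn
      (Eventually.of_forall fun y => Finset.prod_nonneg fun j _ => (h j).nonneg _ _),
      ← integral_indicator hSm]
    simp_rw [hprod]
    rw [integral_fintype_prod_eq_prod, ENNReal.ofReal_prod_of_nonneg fun j _ =>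
      integral_nonneg fun y => indicator_nonneg (fun y _ => (h j).nonneg _ _) y]
    refine Finset.prod_congr rfl fun j _ => ?_
    rw [integral_indicator (hS j), ofReal_integral_eq_lintegral_ofReal (hint j).integrableOn
      (Eventually.of_forall fun y => (h j).nonneg _ _), ← withDensity_apply _ (hS j),
      ← (h j).eq_withDensity]

/-- The channel that applies `κ` to every coordinate. -/
def coordinatewise (κ : Kernel EReal EReal) [IsMarkovKernel κ] :
    Kernel (ι → EReal) (ι → EReal) where
  toFun y := Measure.pi fun j => κ (y j)
  measurable' := by
    refine Measurable.measure_of_isPiSystem_of_isProbabilityMeasure generateFrom_pi.symm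
      isPiSystem_pi ?_
    rintro _ ⟨S, hS, rfl⟩
    simp_rw [Measure.pi_pi]
    exact Finset.measurable_fun_prod _ fun j _ =>
      (κ.measurable_coe (hS j (mem_univ j))).comp (measurable_pi_apply j)

instance (κ : Kernel EReal EReal) [IsMarkovKernel κ] :
    IsMarkovKernel (coordinatewise (ι := ι) κ) :=
  ⟨fun y => by change IsProbabilityMeasure (Measure.pi fun j => κ (y j)); infer_instance⟩

/-- The bound by `1` keeps all integrals finite, so the product formula for real integrands applies.
-/
theorem lintegral_prod_pi (m : ι → Measure EReal) [∀ j, IsProbabilityMeasure (m j)]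
    {F : ι → EReal → ENNReal} (hF : ∀ j, Measurable (F j)) (hF1 : ∀ j y, F j y ≤ 1) :
    ∫⁻ y, ∏ j, F j (y j) ∂(Measure.pi m) = ∏ j, ∫⁻ y, F j y ∂(m j) := by
  have hne : ∀ j y, F j y ≠ ⊤ := fun j y => ne_top_of_le_ne_top ENNReal.one_ne_top (hF1 j y)
  have hint : ∀ j, Integrable (fun y => (F j y).toReal) (m j) := fun j =>
    integrable_of_abs_le (hF j).ennreal_toReal (C := 1) fun y => by
      rw [abs_of_nonneg ENNReal.toReal_nonneg]
      simpa using ENNReal.toReal_mono ENNReal.one_ne_top (hF1 j y)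
  have h : ∀ j, ∫⁻ y, F j y ∂(m j) = ENNReal.ofReal (∫ y, (F j y).toReal ∂(m j)) := fun j => by
    rw [ofReal_integral_eq_lintegral_ofReal (hint j)
      (Eventually.of_forall fun y => ENNReal.toReal_nonneg)]
    simp_rw [ENNReal.ofReal_toReal (hne _ _)]
  simp_rw [h]
  rw [← ENNReal.ofReal_prod_of_nonneg fun j _ => integral_nonneg fun y => ENNReal.toReal_nonneg,
    ← integral_fintype_prod_eq_prod, ofReal_integral_eq_lintegral_ofReal
      (Integrable.fintype_prod hint)
      (Eventually.of_forall fun y => Finset.prod_nonneg fun j _ => ENNReal.toReal_nonneg)]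
  simp_rw [ENNReal.ofReal_prod_of_nonneg (fun j _ => ENNReal.toReal_nonneg),
    ENNReal.ofReal_toReal (hne _ _)]

/-- Degrading each symbol channel degrades the vector channel, which is what makes the extrinsic
moments monotone in the parameter. -/
theorem memoryless_comp (K : Kernel ℤˣ EReal) [IsMarkovKernel K] (κ : Kernel EReal EReal)
    [IsMarkovKernel κ] :
    memoryless (fun _ : ι => κ ∘ₖ K) = coordinatewise κ ∘ₖ memoryless (fun _ : ι => K) := by
  ext1 x
  change Measure.pi (fun j => (κ ∘ₖ K) (x j)) = _
  refine Measure.pi_eq fun S hS => ?_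
  rw [Kernel.comp_apply' _ _ _ (.univ_pi hS)]
  change ∫⁻ y, Measure.pi (fun j => κ (y j)) (univ.pi S) ∂(Measure.pi fun j => K (x j)) = _
  simp_rw [Measure.pi_pi]
  rw [lintegral_prod_pi (fun j => K (x j)) (F := fun j y => κ y (S j))
    (fun j => κ.measurable_coe (hS j)) fun j y => prob_le_one]
  exact Finset.prod_congr rfl fun j _ => (Kernel.comp_apply' _ _ _ (hS j)).symm

end Memoryless

/-! ### Splitting off one coordinate -/

section Split

variable {N : ℕ} (i : Fin N)

/-- The vector with `i`-th coordinate `q.2` and the other coordinates `q.1`. -/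
def insertAt {S : Type*} (q : ({j : Fin N // j ≠ i} → S) × S) (j : Fin N) : S :=
  if h : j ≠ i then q.1 ⟨j, h⟩ else q.2

theorem insertAt_self {S : Type*} (q : ({j : Fin N // j ≠ i} → S) × S) : insertAt i q i = q.2 := by
  simp [insertAt]

theorem insertAt_of_ne {S : Type*} (q : ({j : Fin N // j ≠ i} → S) × S) (j : {j : Fin N // j ≠ i}) :
    insertAt i q j = q.1 j := by
  simp [insertAt, j.2]

theorem prod_eq_prod_subtype_mul {M : Type*} [CommMonoid M] (F : Fin N → M) :
    ∏ j, F j = (∏ j : {j : Fin N // j ≠ i}, F j) * F i := by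
  rw [← Finset.prod_erase_mul _ _ (Finset.mem_univ i), ← Finset.prod_subtype]
  simp

/-- This separates the output at position `i` from the others inside integrals. -/
theorem measurePreserving_insertAt (m : Fin N → Measure EReal) [∀ j, IsProbabilityMeasure (m j)] :
    MeasurePreserving (insertAt i)
      ((Measure.pi fun j : {j : Fin N // j ≠ i} => m j).prod (m i)) (Measure.pi m) := by
  have hmeas : Measurable (insertAt i : ({j : Fin N // j ≠ i} → EReal) × EReal → Fin N → EReal) := by
    refine measurable_pi_lambda _ fun j => ?_
    by_cases h : j = i
    · simp only [insertAt, h, ne_eq, not_true_eq_false, dite_false]; fun_prop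
    · simp only [insertAt, ne_eq, h, not_false_eq_true, dite_true]; fun_prop
  refine ⟨hmeas, (Measure.pi_eq fun S hS => ?_).symm⟩
  have hpre : insertAt i ⁻¹' univ.pi S =
      (univ.pi fun j : {j : Fin N // j ≠ i} => S j) ×ˢ S i := by
    ext q
    simp only [mem_preimage, mem_univ_pi, mem_prod]
    refine ⟨fun h => ⟨fun j => ?_, ?_⟩, fun h j => ?_⟩
    · rw [← insertAt_of_ne i q j]; exact h j
    · rw [← insertAt_self i q]; exact h i
    · by_cases hj : j = i
      · subst hj; rw [insertAt_self]; exact h.2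
      · exact (insertAt_of_ne i q ⟨j, hj⟩) ▸ h.1 ⟨j, hj⟩
  rw [Measure.map_apply hmeas (.univ_pi hS), hpre, Measure.prod_prod, Measure.pi_pi,
    prod_eq_prod_subtype_mul i]

theorem map_restrict_pi (m : Fin N → Measure EReal) [∀ j, IsProbabilityMeasure (m j)] :
    (Measure.pi m).map (fun y (j : {j : Fin N // j ≠ i}) => y j) =
      Measure.pi fun j : {j : Fin N // j ≠ i} => m j := by
  have hr : Measurable fun (y : Fin N → EReal) (j : {j : Fin N // j ≠ i}) => y j := by fun_prop
  rw [← (measurePreserving_insertAt i m).map_eq,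
    Measure.map_map hr (measurePreserving_insertAt i m).measurable]
  have : (fun (y : Fin N → EReal) (j : {j : Fin N // j ≠ i}) => y j) ∘ insertAt i = Prod.fst := by
    ext q j; exact insertAt_of_ne i q j
  rw [this, ← Measure.fst, Measure.fst_prod]

/-- The channel from the full input to the outputs at the positions other than `i`. -/
def extrinsic (K : Kernel ℤˣ EReal) : Kernel (Fin N → ℤˣ) ({j : Fin N // j ≠ i} → EReal) :=
  (memoryless fun _ : {j : Fin N // j ≠ i} => K).comap (fun x j => x j) (measurable_of_countable _)

instance (K : Kernel ℤˣ EReal) [IsMarkovKernel K] : IsMarkovKernel (extrinsic i K) := by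
  unfold extrinsic; infer_instance

theorem extrinsic_comp (K : Kernel ℤˣ EReal) [IsMarkovKernel K] (κ : Kernel EReal EReal)
    [IsMarkovKernel κ] : extrinsic i (κ ∘ₖ K) = coordinatewise κ ∘ₖ extrinsic i K := by
  unfold extrinsic
  rw [memoryless_comp]
  rfl

theorem hasDensity_extrinsic {K : Kernel ℤˣ EReal} [IsMarkovKernel K] {m : Measure EReal}
    [IsProbabilityMeasure m] {k : ℤˣ → EReal → ℝ} (h : HasDensity K m k) :
    HasDensity (extrinsic i K) (Measure.pi fun _ => m) (fun x y => ∏ j, k (x j.1) (y j)) := by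
  have := hasDensity_memoryless (ι := {j : Fin N // j ≠ i}) (K := fun _ => K) (m := fun _ => m)
    fun _ => h
  obtain ⟨C, hC⟩ := this.bounded
  exact ⟨fun x => this.measurable _, fun x y => this.nonneg _ _, ⟨C, fun x y => hC _ _⟩,
    fun x => this.eq_withDensity _⟩

theorem map_jointLaw_extrinsic (W : ℝ → Kernel ℤˣ EReal) (t : ℝ) [IsMarkovKernel (W t)]
    (p : Measure (Fin N → ℤˣ)) [IsProbabilityMeasure p] :
    (jointLaw W p fun _ => t).map (fun ω => (ω.1, fun j : {j : Fin N // j ≠ i} => ω.2 j)) =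
      p ⊗ₘ extrinsic i (W t) := by
  have hr : Measurable fun (y : Fin N → EReal) (j : {j : Fin N // j ≠ i}) => y j := by fun_prop
  have hker : extrinsic i (W t) = (memoryless fun _ : Fin N => W t).map
      (fun y (j : {j : Fin N // j ≠ i}) => y j) := by
    ext1 x
    rw [Kernel.map_apply _ hr]
    exact (map_restrict_pi i fun j => W t (x j)).symm
  rw [hker, Measure.compProd_map hr]
  rfl

end Split

instance {N : ℕ} {W : ℝ → Kernel ℤˣ EReal} {p : Measure (Fin N → ℤˣ)} [IsProbabilityMeasure p]
    {s : Fin N → ℝ} [∀ j, IsMarkovKernel (W (s j))] : IsProbabilityMeasure (jointLaw W p s) := by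
  unfold jointLaw; infer_instance

theorem extrinsicMMSE_eq {N : ℕ} {W : ℝ → Kernel ℤˣ EReal} {t : ℝ} [IsMarkovKernel (W t)]
    {p : Measure (Fin N → ℤˣ)} [IsProbabilityMeasure p] {i : Fin N}
    {z : ({j : Fin N // j ≠ i} → EReal) → ℝ}
    (hz : IsPosteriorMean p (extrinsic i (W t)) (fun x => sgn (x i)) z) :
    extrinsicMMSE W p i t = 1 - moment p (extrinsic i (W t)) z 0 :=
  mmse_eq_one_sub_moment (X := Prod.fst) 
    (Y := fun (ω : (Fin N → ℤˣ) × (Fin N → EReal)) (j : {j : Fin N // j ≠ i}) => ω.2 j) hz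
    (fun x => sgn_sq _) measurable_fst (by fun_prop) (map_jointLaw_extrinsic i W t p)

/-! ### The entropy of the input as a function of one channel -/

theorem exists_abs_negMulLog_le (C : ℝ) : ∃ B, ∀ u, 0 ≤ u → u ≤ C → |Real.negMulLog u| ≤ B := by
  obtain ⟨B, hB⟩ := (isCompact_Icc (a := (0 : ℝ)) (b := C)).exists_bound_of_continuousOn
    Real.continuous_negMulLog.continuousOn
  exact ⟨B, fun u h0 h1 => hB u ⟨h0, h1⟩⟩

section EntropySplit

variable {α β : Type*} [MeasurableSpace α] [MeasurableSpace β] {p : Measure α} {K : Kernel α β} {m : Measure β} {k : α → β → ℝ}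
  {L : Kernel ℤˣ EReal} {m' : Measure EReal} {D : EReal → ℝ}

theorem HasDensity.integrable_weight [IsFiniteMeasure m] (hK : HasDensity K m k) (x : α) :
    Integrable (fun y => p.real {x} * k x y) m := by
  simpa using (hK.integrable_mul x (F := fun _ => 1) (integrable_const _)).const_mul (p.real {x})

theorem HasDensity.integrable_negMulLog_weight [IsFiniteMeasure m] (hK : HasDensity K m k)
    (x : α) : Integrable (fun y => Real.negMulLog (p.real {x} * k x y)) m := by
  obtain ⟨C, hC⟩ := hK.bounded
  obtain ⟨B, hB⟩ := exists_abs_negMulLog_le (p.real {x} * C)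
  exact integrable_of_abs_le (Real.continuous_negMulLog.measurable.comp
    ((hK.measurable x).const_mul _)) fun y => hB _ (hK.weight_nonneg x y)
      (mul_le_mul_of_nonneg_left (hC x y) measureReal_nonneg)

/-- With `φ = negMulLog`, `φ(ab) = φ(a) b + a φ(b)`. Here `b = 1 ± D` integrates to `1` and `φ(b)`
to minus the gap, whichever the sign. -/
theorem HasDensity.integral_negMulLog_weight_mul [IsProbabilityMeasure m]
    (hK : HasDensity K m k) (hL : IsSymmetricDensity L m' D) (x : α) (σ : ℤˣ) :
    Integrable (fun q : β × EReal =>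
        Real.negMulLog (p.real {x} * k x q.1 * (1 + sgn σ * D q.2))) (m.prod m') ∧
      ∫ q, Real.negMulLog (p.real {x} * k x q.1 * (1 + sgn σ * D q.2)) ∂(m.prod m') =
        ∫ y, Real.negMulLog (p.real {x} * k x y) ∂m -
          (∫ y, p.real {x} * k x y ∂m) * ∫ y, entropyGap (D y) ∂m' := by
  have := hL.isProbabilityMeasure
  have h1 : Integrable (fun y => 1 + sgn σ * D y) m' :=
    (integrable_const _).add (hL.integrable.const_mul _)
  have h2 := hL.integrable_negMulLog (abs_sgn σ).le
  have h3 := (hK.integrable_negMulLog_weight (p := p) x).mul_prod h1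
  have h4 := (hK.integrable_weight (p := p) x).mul_prod h2
  have heq : (fun q : β × EReal =>
      Real.negMulLog (p.real {x} * k x q.1 * (1 + sgn σ * D q.2))) =
      fun q => Real.negMulLog (p.real {x} * k x q.1) * (1 + sgn σ * D q.2) +
        p.real {x} * k x q.1 * Real.negMulLog (1 + sgn σ * D q.2) := by
    ext q; rw [Real.negMulLog_mul (p.real {x} * k x q.1)]; ring
  have hgap : ∫ y, entropyGap (sgn σ * D y) ∂m' = ∫ y, entropyGap (D y) ∂m' := by
    rcases Int.units_eq_one_or σ with rfl | rfl <;> simp [sgn, entropyGap_neg]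
  have hone : ∫ y, (1 + sgn σ * D y) ∂m' = 1 := by
    rw [integral_add (integrable_const _) (hL.integrable.const_mul _), integral_const_mul,
      hL.integral_eq_zero]
    simp
  rw [heq]
  refine ⟨h3.add h4, ?_⟩
  rw [integral_add h3 h4, integral_prod_mul (fun y => Real.negMulLog (p.real {x} * k x y))
      (fun y => 1 + sgn σ * D y), integral_prod_mul (fun y => p.real {x} * k x y)
      (fun y => Real.negMulLog (1 + sgn σ * D y)), hone,
    hL.integral_negMulLog (abs_sgn σ).le, hgap]
  ring

variable [Fintype α]

theorem HasDensity.integrable_evidence [IsFiniteMeasure m] (hK : HasDensity K m k) :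
    Integrable (evidence p k) m :=
  integrable_finsetSum _ fun x _ => hK.integrable_weight x

theorem HasDensity.integrable_negMulLog_evidence [IsFiniteMeasure m] (hK : HasDensity K m k) :
    Integrable (fun y => Real.negMulLog (evidence p k y)) m := by
  obtain ⟨C, hC⟩ := hK.evidence_bounded (p := p)
  obtain ⟨B, hB⟩ := exists_abs_negMulLog_le C
  exact integrable_of_abs_le (Real.continuous_negMulLog.measurable.comp hK.measurable_evidence)
    fun y => hB _ (hK.evidence_nonneg y) (hC y)

theorem HasDensity.sum_weight_mul (hK : HasDensity K m k) (f : α → ℝ) (y : β) (d : ℝ) :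
    ∑ x, p.real {x} * k x y * (1 + f x * d) =
      evidence p k y * (1 + posterior p k f y * d) := by
  simp_rw [mul_add, mul_one, Finset.sum_add_distrib]
  rw [← mul_assoc, hK.evidence_mul_posterior, Finset.sum_mul]
  simp_rw [mul_assoc]
  rfl

/-- The same product rule with the posterior mean in place of the sign. The term linear in `D`
integrates to zero, and the gap at `posterior * D` is what couples channel `L` to the others. -/
theorem HasDensity.integral_negMulLog_evidence_mul [IsProbabilityMeasure m]
    (hK : HasDensity K m k) (hL : IsSymmetricDensity L m' D) {f : α → ℝ} (hf : ∀ x, |f x| ≤ 1) :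
    Integrable (fun q : β × EReal =>
        Real.negMulLog (evidence p k q.1 * (1 + posterior p k f q.1 * D q.2))) (m.prod m') ∧
      ∫ q, Real.negMulLog (evidence p k q.1 * (1 + posterior p k f q.1 * D q.2)) ∂(m.prod m') =
        ∫ y, Real.negMulLog (evidence p k y) ∂m -
          ∫ q, evidence p k q.1 * entropyGap (posterior p k f q.1 * D q.2) ∂(m.prod m') := by
  have := hL.isProbabilityMeasure
  have hzm := hK.measurable_posterior (p := p) f
  have hz1 := hK.abs_posterior_le (p := p) hf
  have hzD : ∀ q : β × EReal, |posterior p k f q.1 * D q.2| ≤ 1 := fun q => by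
    rw [abs_mul]; exact mul_le_one₀ (hz1 _) (abs_nonneg _) (hL.abs_le_one _)
  have hzDm : Measurable fun q : β × EReal => posterior p k f q.1 * D q.2 :=
    (hzm.comp measurable_fst).mul (hL.measurable.comp measurable_snd)
  have hA := (hK.integrable_evidence (p := p)).comp_fst m'
  have hphi := (hK.integrable_negMulLog_evidence (p := p)).comp_fst m'
  have hphiz : Integrable (fun q : β × EReal => Real.negMulLog (evidence p k q.1) *
      posterior p k f q.1 * D q.2) (m.prod m') :=
    ((hK.integrable_negMulLog_evidence (p := p)).mul_bdd (c := 1) hzm.aestronglyMeasurable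
      (Eventually.of_forall hz1)).mul_prod hL.integrable
  obtain ⟨B, hB⟩ := exists_abs_negMulLog_le 2
  have hAphi : Integrable (fun q : β × EReal => evidence p k q.1 *
      Real.negMulLog (1 + posterior p k f q.1 * D q.2)) (m.prod m') := by
    refine hA.mul_bdd (c := B) (Real.continuous_negMulLog.measurable.comp
      (hzDm.const_add 1)).aestronglyMeasurable (Eventually.of_forall fun q => ?_)
    obtain ⟨h1, h2⟩ := abs_le.1 (hzD q)
    exact hB _ (by linarith) (by linarith)
  obtain ⟨B', hB'⟩ := (isCompact_Icc (a := (-1 : ℝ)) (b := 1)).exists_bound_of_continuousOn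
    continuous_entropyGap.continuousOn
  have hAgap : Integrable (fun q : β × EReal => evidence p k q.1 *
      entropyGap (posterior p k f q.1 * D q.2)) (m.prod m') :=
    hA.mul_bdd (c := B') (continuous_entropyGap.measurable.comp hzDm).aestronglyMeasurable
      (Eventually.of_forall fun q => hB' _ (abs_le.1 (hzD q)))
  have heq : (fun q : β × EReal =>
      Real.negMulLog (evidence p k q.1 * (1 + posterior p k f q.1 * D q.2))) =
      fun q => (Real.negMulLog (evidence p k q.1) +
        Real.negMulLog (evidence p k q.1) * posterior p k f q.1 * D q.2) +
        evidence p k q.1 * Real.negMulLog (1 + posterior p k f q.1 * D q.2) := by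
    ext q; rw [Real.negMulLog_mul (evidence p k q.1)]; ring
  have h12 : Integrable (fun q : β × EReal => Real.negMulLog (evidence p k q.1) +
      Real.negMulLog (evidence p k q.1) * posterior p k f q.1 * D q.2) (m.prod m') :=
    hphi.add hphiz
  rw [heq]
  refine ⟨h12.add hAphi, ?_⟩
  rw [integral_add h12 hAphi, integral_add hphi hphiz, integral_prod _ hAphi,
    integral_prod _ hAgap]
  have e1 : ∫ q : β × EReal, Real.negMulLog (evidence p k q.1) ∂(m.prod m') =
      ∫ y, Real.negMulLog (evidence p k y) ∂m := by
    rw [integral_fun_fst (fun y => Real.negMulLog (evidence p k y))]; simp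
  have e2 : ∫ q : β × EReal, Real.negMulLog (evidence p k q.1) * posterior p k f q.1 * D q.2
      ∂(m.prod m') = 0 := by
    rw [integral_prod_mul (fun y => Real.negMulLog (evidence p k y) * posterior p k f y) D,
      hL.integral_eq_zero, mul_zero]
  rw [e1, e2, add_zero, sub_eq_add_neg, ← integral_neg]
  congr 2
  ext y
  dsimp only
  rw [integral_const_mul, integral_const_mul, hL.integral_negMulLog (hz1 y)]
  ring

/-- The entropy integral of a product channel, as a series in the even moments. -/
theorem HasDensity.hasSum_entropy_integral [MeasurableSingletonClass α] [IsProbabilityMeasure p]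
    [IsMarkovKernel K] [IsProbabilityMeasure m] (hK : HasDensity K m k) (ι : α → ℤˣ) :
    ∃ C : ℝ, ∀ (L : Kernel ℤˣ EReal) (m' : Measure EReal) (D : EReal → ℝ),
      IsSymmetricDensity L m' D →
      HasSum (fun n => (1 - moment p K (posterior p k fun x => sgn (ι x)) n) *
        (gapCoeff n * (1 - evenMoment m' D n)))
        (∫ q, (∑ x, Real.negMulLog (p.real {x} * (k x q.1 * (1 + sgn (ι x) * D q.2))) -
          Real.negMulLog (∑ x, p.real {x} * (k x q.1 * (1 + sgn (ι x) * D q.2))))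
            ∂(m.prod m') - C) := by
  set z := posterior p k fun x => sgn (ι x) with hz
  have hf : ∀ x, |sgn (ι x)| ≤ 1 := fun x => (abs_sgn _).le
  have hzm : Measurable z := hK.measurable_posterior _
  have hz1 : ∀ y, |z y| ≤ 1 := hK.abs_posterior_le hf
  have hmom : ∀ n, moment p K z n = ∫ y, evidence p k y * z y ^ (2 * n + 2) ∂m := fun n => by
    rw [moment, hK.expect_output_eq]
    refine integrable_of_abs_le (hzm.pow_const _) (C := 1) fun y => ?_
    rw [abs_pow]; exact pow_le_one₀ (abs_nonneg _) (hz1 y)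
  have hB := hasSum_integral_mul_pow (hK.integrable_evidence (p := p)) hzm
    fun y => abs_le.1 (hz1 y)
  simp_rw [← hmom] at hB
  -- `C` collects what does not depend on `L`. It is chosen so that the rest is `∑ c_n (1 - b_n -
  -- a_n + a_n b_n) = ∑ c_n (1 - a_n)(1 - b_n)`, with `a_n` the moments of `z` and `b_n` those of
  -- `D`.
  refine ⟨∑ x, ∫ y, Real.negMulLog (p.real {x} * k x y) ∂m -
    ∫ y, Real.negMulLog (evidence p k y) ∂m - Real.log 2 +
    ∫ y, evidence p k y * entropyGap (z y) ∂m, fun L m' D hL => ?_⟩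
  have := hL.isProbabilityMeasure
  have hw := fun x => hK.integral_negMulLog_weight_mul (p := p) hL x (ι x)
  have he := hK.integral_negMulLog_evidence_mul (p := p) hL hf
  have hP := hasSum_integral_mul_pow ((hK.integrable_evidence (p := p)).comp_fst m')
    (U := fun q : β × EReal => z q.1 * D q.2)
    ((hzm.comp measurable_fst).mul (hL.measurable.comp measurable_snd)) fun q => abs_le.1 (by
      rw [abs_mul]; exact mul_le_one₀ (hz1 _) (abs_nonneg _) (hL.abs_le_one _))
  have hPm : ∀ n, ∫ q : β × EReal, evidence p k q.1 * (z q.1 * D q.2) ^ (2 * n + 2)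
      ∂(m.prod m') = moment p K z n * evenMoment m' D n := fun n => by
    rw [hmom, evenMoment, ← integral_prod_mul]
    congr 1; ext q; ring
  simp_rw [hPm] at hP
  have hval : ∫ q, (∑ x, Real.negMulLog (p.real {x} * (k x q.1 * (1 + sgn (ι x) * D q.2))) -
      Real.negMulLog (∑ x, p.real {x} * (k x q.1 * (1 + sgn (ι x) * D q.2)))) ∂(m.prod m') =
      ∑ x, ∫ y, Real.negMulLog (p.real {x} * k x y) ∂m - ∫ y, entropyGap (D y) ∂m' -
      (∫ y, Real.negMulLog (evidence p k y) ∂m -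
        ∫ q, evidence p k q.1 * entropyGap (z q.1 * D q.2) ∂(m.prod m')) := by
    simp_rw [← mul_assoc, hK.sum_weight_mul (fun x => sgn (ι x))]
    rw [integral_sub (integrable_finsetSum _ fun x _ => (hw x).1) he.1, he.2,
      integral_finsetSum _ fun x _ => (hw x).1]
    simp_rw [fun x => (hw x).2]
    rw [Finset.sum_sub_distrib, ← Finset.sum_mul,
      ← integral_finsetSum _ fun x _ => hK.integrable_weight x]
    have := hK.integral_evidence (p := p)
    unfold evidence at this
    rw [this, one_mul]
  rw [hval]
  have hsum := ((hasSum_gapCoeff.sub hL.hasSum_evenMoment).sub hB).add hP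
  have hrhs : ∑ x, ∫ y, Real.negMulLog (p.real {x} * k x y) ∂m - ∫ y, entropyGap (D y) ∂m' -
      (∫ y, Real.negMulLog (evidence p k y) ∂m -
        ∫ q, evidence p k q.1 * entropyGap (z q.1 * D q.2) ∂(m.prod m')) -
      (∑ x, ∫ y, Real.negMulLog (p.real {x} * k x y) ∂m -
        ∫ y, Real.negMulLog (evidence p k y) ∂m - Real.log 2 +
        ∫ y, evidence p k y * entropyGap (z y) ∂m) =
      Real.log 2 - ∫ y, entropyGap (D y) ∂m' - ∫ y, evidence p k y * entropyGap (z y) ∂m +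
        ∫ q, evidence p k q.1 * entropyGap (z q.1 * D q.2) ∂(m.prod m') := by ring
  rw [hrhs]
  exact hsum.congr_fun fun n => by ring

end EntropySplit

/-- The partial entropy as a function of the channel of the `i`-th symbol. -/
theorem hasSum_partialEntropy {N : ℕ} {W : ℝ → Kernel ℤˣ EReal} {t : ℝ} [IsMarkovKernel (W t)]
    {m : Measure EReal} {D : EReal → ℝ} (ht : IsSymmetricDensity (W t) m D)
    (p : Measure (Fin N → ℤˣ)) [IsProbabilityMeasure p] (i : Fin N) :
    ∃ C : ℝ, ∀ s, IsMarkovKernel (W s) → ∀ m' D', IsSymmetricDensity (W s) m' D' →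
      HasSum (fun n => (1 - moment p (extrinsic i (W t)) (posterior p
          (fun x y => ∏ j, (1 + sgn (x j.1) * D (y j))) (fun x => sgn (x i))) n) *
        (gapCoeff n * (1 - evenMoment m' D' n) / Real.log 2)) (partialEntropy W p i t s - C) := by
  have := ht.isProbabilityMeasure
  obtain ⟨C, hC⟩ := (hasDensity_extrinsic i ht.hasDensity).hasSum_entropy_integral (p := p)
    fun x => x i
  refine ⟨C / Real.log 2, fun s hs m' D' hD' => ?_⟩
  have := hD'.isProbabilityMeasure
  have hsum := (hC _ _ _ hD').div_const (Real.log 2)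
  set M : Fin N → Measure EReal := Function.update (fun _ => m) i m' with hM
  set DD : Fin N → EReal → ℝ := Function.update (fun _ => D) i D' with hDD
  have hsym : ∀ j, IsSymmetricDensity (W (Function.update (fun _ => t) i s j)) (M j) (DD j) := by
    intro j
    by_cases hj : j = i
    · subst hj; simpa [hM, hDD] using hD'
    · simpa [hM, hDD, hj] using ht
  have hmk : ∀ j, IsMarkovKernel (W (Function.update (fun _ => t) i s j)) := by
    intro j
    by_cases hj : j = i
    · subst hj; simpa using hs
    · simpa [hj]
  have hpm : ∀ j, IsProbabilityMeasure (M j) := fun j => (hsym j).isProbabilityMeasure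
  have hdens := hasDensity_memoryless fun j => (hsym j).hasDensity
  have hent := hdens.condEntropy_eq (p := p) (μ := jointLaw W p (Function.update (fun _ => t) i s))
    (X := Prod.fst) measurable_fst measurable_snd (by simp [jointLaw])
  have hpart : partialEntropy W p i t s - C / Real.log 2 = ((∫ q, (∑ x, Real.negMulLog
      (p.real {x} * ((∏ j : {j : Fin N // j ≠ i}, (1 + sgn (x j.1) * D (q.1 j))) *
        (1 + sgn (x i) * D' q.2))) - Real.negMulLog (∑ x, p.real {x} *
        ((∏ j : {j : Fin N // j ≠ i}, (1 + sgn (x j.1) * D (q.1 j))) *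
        (1 + sgn (x i) * D' q.2)))) ∂((Measure.pi fun _ => m).prod m')) - C) / Real.log 2 := by
    rw [sub_div]
    congr 1
    unfold partialEntropy
    rw [hent]
    congr 1
    have hmp := measurePreserving_insertAt i M
    have hMi : M i = m' := by simp [hM]
    have hMj : (fun j : {j : Fin N // j ≠ i} => M j) = fun _ => m := by
      ext1 j; simp [hM, j.2]
    rw [hMi, hMj] at hmp
    have hmeas : Measurable fun y : Fin N → EReal => ∑ x : Fin N → ℤˣ,
        Real.negMulLog (p.real {x} * ∏ j, (1 + sgn (x j) * DD j (y j))) -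
        Real.negMulLog (evidence p (fun x y => ∏ j, (1 + sgn (x j) * DD j (y j))) y) :=
      (Finset.measurable_fun_sum _ fun x _ => Real.continuous_negMulLog.measurable.comp
        ((hdens.measurable x).const_mul _)).sub
        (Real.continuous_negMulLog.measurable.comp hdens.measurable_evidence)
    rw [← hmp.map_eq, integral_map hmp.measurable.aemeasurable hmeas.aestronglyMeasurable]
    have hprod : ∀ (x : Fin N → ℤˣ) (q : ({j : Fin N // j ≠ i} → EReal) × EReal),
        ∏ j, (1 + sgn (x j) * DD j (insertAt i q j)) =
        (∏ j : {j : Fin N // j ≠ i}, (1 + sgn (x j.1) * D (q.1 j))) *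
          (1 + sgn (x i) * D' q.2) := fun x q => by
      rw [prod_eq_prod_subtype_mul i, insertAt_self]
      congr 1
      · refine Finset.prod_congr rfl fun j _ => ?_
        rw [insertAt_of_ne]
        simp [hDD, j.2]
      · simp [hDD]
    simp_rw [evidence, hprod]
  rw [hpart]
  refine hsum.congr_fun fun n => ?_
  ring

/-! ### Families ordered by degradation -/

theorem IsDegraded.moment_le {L K : Kernel ℤˣ EReal} [IsMarkovKernel K] (h : IsDegraded L K)
    {p : Measure ℤˣ} {f : ℤˣ → ℝ} {z u : EReal → ℝ} (hz : IsPosteriorMean p K f z)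
    (hu : IsPosteriorMean p L f u) (k : ℕ) : moment p L u k ≤ moment p K z k := by
  obtain ⟨κ, hκ, rfl⟩ := h
  exact hz.moment_comp_le hu k

theorem IsDegraded.moment_extrinsic_le {N : ℕ} {i : Fin N} {L K : Kernel ℤˣ EReal}
    [IsMarkovKernel K] (h : IsDegraded L K) {p : Measure (Fin N → ℤˣ)} {f : (Fin N → ℤˣ) → ℝ}
    {z u : ({j : Fin N // j ≠ i} → EReal) → ℝ} (hz : IsPosteriorMean p (extrinsic i K) f z)
    (hu : IsPosteriorMean p (extrinsic i L) f u) (k : ℕ) :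
    moment p (extrinsic i L) u k ≤ moment p (extrinsic i K) z k := by
  obtain ⟨κ, hκ, rfl⟩ := h
  rw [extrinsic_comp] at hu ⊢
  exact hz.moment_comp_le hu k

/-- The function `c_k (1 - 𝔼[D(t)^(2k+2)])`, in bits: the `k`-th term of the entropy series. -/
def entropyTerm (m : ℝ → Measure EReal) (D : ℝ → EReal → ℝ) (k : ℕ) (t : ℝ) : ℝ :=
  gapCoeff k * (1 - evenMoment (m t) (D t) k) / Real.log 2

/-- The conditional mean of the `i`-th symbol given the other outputs. -/
def extrinsicMean {N : ℕ} (D : ℝ → EReal → ℝ) (p : Measure (Fin N → ℤˣ)) (i : Fin N) (t : ℝ) :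
    ({j : Fin N // j ≠ i} → EReal) → ℝ :=
  posterior p (fun x y => ∏ j, (1 + sgn (x j.1) * D t (y j))) (fun x => sgn (x i))

/-- The weight `1 - 𝔼[𝔼[X_i ∣ Y_{∼i}(t)]^(2k+2)]` of the `k`-th term in the GEXIT function. -/
def gexitWeight {N : ℕ} (W : ℝ → Kernel ℤˣ EReal) (D : ℝ → EReal → ℝ) (p : Measure (Fin N → ℤˣ))
    (i : Fin N) (k : ℕ) (t : ℝ) : ℝ :=
  1 - moment p (extrinsic i (W t)) (extrinsicMean D p i t) k

section Family

variable {W : ℝ → Kernel ℤˣ EReal} {m : ℝ → Measure EReal} {D : ℝ → EReal → ℝ}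

theorem IsBMSFamily.monotoneOn_entropyTerm (hW : IsBMSFamily W)
    (hD : ∀ t ∈ Icc (0 : ℝ) 1, IsSymmetricDensity (W t) (m t) (D t)) (k : ℕ) :
    MonotoneOn (entropyTerm m D k) (Icc 0 1) := by
  intro s hs t ht hst
  have := hW.markov s hs
  have h := (hW.degraded s t hs.1 hst ht.2).moment_le (hD s hs).isPosteriorMean_uniform
    (hD t ht).isPosteriorMean_uniform k
  rw [(hD s hs).moment_uniform, (hD t ht).moment_uniform] at h
  unfold entropyTerm
  have hc := (gapCoeff_pos k).le
  have hlog := (Real.log_pos one_lt_two).le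
  gcongr

/-- The term of index `0` is `c_0 / log 2` times the MMSE function. -/
theorem IsBMSFamily.strictMonoOn_entropyTerm (hW : IsBMSFamily W)
    (hM : StrictMonoOn (mmseFun W) (Icc 0 1))
    (hD : ∀ t ∈ Icc (0 : ℝ) 1, IsSymmetricDensity (W t) (m t) (D t)) :
    StrictMonoOn (entropyTerm m D 0) (Icc 0 1) := by
  intro s hs t ht hst
  have := hW.markov s hs
  have := hW.markov t ht
  have h := hM hs ht hst
  rw [mmseFun_eq (hD s hs), mmseFun_eq (hD t ht)] at h
  exact div_lt_div_of_pos_right (mul_lt_mul_of_pos_left h (gapCoeff_pos 0))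
    (Real.log_pos one_lt_two)

theorem IsBMSFamily.hasSum_entropyTerm (hW : IsBMSFamily W)
    (hD : ∀ t ∈ Icc (0 : ℝ) 1, IsSymmetricDensity (W t) (m t) (D t)) {t : ℝ}
    (ht : t ∈ Icc (0 : ℝ) 1) : HasSum (fun k => entropyTerm m D k t) (entropyFun W t) := by
  have := hW.markov t ht
  rw [entropyFun_eq (hD t ht)]
  refine ((hasSum_gapCoeff.sub (hD t ht).hasSum_evenMoment).div_const _).congr_fun fun k => ?_
  unfold entropyTerm
  ring

variable {N : ℕ} (p : Measure (Fin N → ℤˣ)) (i : Fin N)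

theorem IsBMSFamily.isPosteriorMean_extrinsicMean (hW : IsBMSFamily W)
    (hD : ∀ t ∈ Icc (0 : ℝ) 1, IsSymmetricDensity (W t) (m t) (D t)) {t : ℝ}
    (ht : t ∈ Icc (0 : ℝ) 1) :
    IsPosteriorMean p (extrinsic i (W t)) (fun x => sgn (x i)) (extrinsicMean D p i t) := by
  have := hW.markov t ht
  have := (hD t ht).isProbabilityMeasure
  exact (hasDensity_extrinsic i (hD t ht).hasDensity).isPosteriorMean fun x => (abs_sgn _).le

theorem IsBMSFamily.monotoneOn_gexitWeight (hW : IsBMSFamily W)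
    (hD : ∀ t ∈ Icc (0 : ℝ) 1, IsSymmetricDensity (W t) (m t) (D t)) (k : ℕ) :
    MonotoneOn (gexitWeight W D p i k) (Icc 0 1) := by
  intro s hs t ht hst
  have := hW.markov s hs
  exact sub_le_sub_left ((hW.degraded s t hs.1 hst ht.2).moment_extrinsic_le
    (hW.isPosteriorMean_extrinsicMean p i hD hs)
    (hW.isPosteriorMean_extrinsicMean p i hD ht) k) 1

variable [IsProbabilityMeasure p]

theorem IsBMSFamily.gexitWeight_mem_Icc (hW : IsBMSFamily W)
    (hD : ∀ t ∈ Icc (0 : ℝ) 1, IsSymmetricDensity (W t) (m t) (D t)) (k : ℕ) {t : ℝ}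
    (ht : t ∈ Icc (0 : ℝ) 1) : gexitWeight W D p i k t ∈ Icc (0 : ℝ) 1 := by
  have := hW.markov t ht
  exact ⟨sub_nonneg.2 ((hW.isPosteriorMean_extrinsicMean p i hD ht).moment_le_one k),
    sub_le_self _ (moment_nonneg k)⟩

theorem IsBMSFamily.gexitWeight_zero (hW : IsBMSFamily W)
    (hD : ∀ t ∈ Icc (0 : ℝ) 1, IsSymmetricDensity (W t) (m t) (D t)) {t : ℝ}
    (ht : t ∈ Icc (0 : ℝ) 1) : gexitWeight W D p i 0 t = extrinsicMMSE W p i t := by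
  have := hW.markov t ht
  exact (extrinsicMMSE_eq (hW.isPosteriorMean_extrinsicMean p i hD ht)).symm

/-- For almost every parameter, the derivative defining the GEXIT function exists and is given
by termwise differentiation. -/
theorem IsBMSFamily.ae_hasDerivAt_partialEntropy (hW : IsBMSFamily W)
    (hD : ∀ t ∈ Icc (0 : ℝ) 1, IsSymmetricDensity (W t) (m t) (D t)) :
    ∀ᵐ t : ℝ, t ∈ Ioo (0 : ℝ) 1 → DifferentiableAt ℝ (partialEntropy W p i t) t ∧
      HasSum (fun k => gexitWeight W D p i k t * deriv (entropyTerm m D k) t)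
        (gexit W p i t) := by
  have he := hW.monotoneOn_entropyTerm hD
  have hE : ∀ t ∈ Icc (0 : ℝ) 1, HasSum (fun k => entropyTerm m D k t) (entropyFun W t) :=
    fun t ht => hW.hasSum_entropyTerm hD ht
  -- The exceptional null set depends on the family alone, not on `p` or `i`. At a good `t` the
  -- other channels are frozen, so the weights and `C` are constants and only `s` varies.
  filter_upwards [ae_hasSum_deriv_of_monotoneOn he hE hW.absolutelyContinuous] with t h ht
  obtain ⟨hdk, hdE, hsum⟩ := h ht
  have ht' := Ioo_subset_Icc_self ht
  have := hW.markov t ht'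
  obtain ⟨C, hC⟩ := hasSum_partialEntropy (hD t ht') p i
  have hw := fun k => hW.gexitWeight_mem_Icc p i hD k ht'
  have hd : ∀ k, 0 ≤ deriv (entropyTerm m D k) t := fun k => (he k).deriv_nonneg_of_mem_Ioo ht
  have hs : Summable fun k => gexitWeight W D p i k t * deriv (entropyTerm m D k) t :=
    Summable.of_nonneg_of_le (fun k => mul_nonneg (hw k).1 (hd k))
      (fun k => mul_le_of_le_one_left (hd k) (hw k).2) hsum.summable
  have hder : HasDerivAt (fun s => partialEntropy W p i t s - C) _ t :=
    hasDerivAt_of_hasSum_mul_monotoneOn he hE ht hdk hdE hsum (fun k => (hw k).1)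
      (fun k => (hw k).2) (fun s hs => hC s (hW.markov s hs) _ _ (hD s hs)) hs.hasSum
  have hder' : HasDerivAt (partialEntropy W p i t)
      (∑' k, gexitWeight W D p i k t * deriv (entropyTerm m D k) t) t := by
    simpa using hder.add_const C
  refine ⟨hder'.differentiableAt, ?_⟩
  rw [gexit, derivWithin_of_mem_nhds (Icc_mem_nhds ht.1 ht.2), hder'.deriv]
  exact hs.hasSum

end Family

/-! ### Choice of densities along the family, and conclusion. -/

theorem IsBMSFamily.exists_isSymmetricDensity {W : ℝ → Kernel ℤˣ EReal} (hW : IsBMSFamily W) :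
    ∃ (m : ℝ → Measure EReal) (D : ℝ → EReal → ℝ),
      ∀ t ∈ Icc (0 : ℝ) 1, IsSymmetricDensity (W t) (m t) (D t) := by
  have h : ∀ t, ∃ (m : Measure EReal) (D : EReal → ℝ),
      t ∈ Icc (0 : ℝ) 1 → IsSymmetricDensity (W t) m D := fun t => by
    by_cases ht : t ∈ Icc (0 : ℝ) 1
    · have := hW.markov t ht
      obtain ⟨m, D, h⟩ := BMS.exists_isSymmetricDensity (W t) (hW.symmetric t ht)
      exact ⟨m, D, fun _ => h⟩
    · exact ⟨0, 0, fun h => absurd h ht⟩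
  choose m D hD using h
  exact ⟨m, D, hD⟩

end BMS

end

theorem mainTheorem11 (W : ℝ → Kernel ℤˣ EReal) (hW : BMS.IsBMSFamily W)
    (hM : StrictMonoOn (BMS.mmseFun W) (Icc 0 1))
    (N : ℕ → ℕ) (p : ∀ n, Measure (Fin (N n) → ℤˣ)) (hp : ∀ n, IsProbabilityMeasure (p n))
    (i : ∀ n, Fin (N n)) :
    (∀ n, (∀ᵐ t ∂(volume.restrict (Icc (0 : ℝ) 1)),
          DifferentiableWithinAt ℝ (BMS.partialEntropy W (p n) (i n) t) (Icc 0 1) t) ∧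
        IntervalIntegrable (BMS.gexit W (p n) (i n)) volume 0 1) ∧
    ∀ t' ∈ Ioo (0 : ℝ) 1,
      (Tendsto (fun n => ∫ s in (0 : ℝ)..t', BMS.gexit W (p n) (i n) s) atTop (𝓝 0) ↔
        ∀ s ∈ Ico 0 t', Tendsto (fun n => BMS.extrinsicMMSE W (p n) (i n) s) atTop (𝓝 0)) ∧
      (Tendsto (fun n => ∫ s in t'..(1 : ℝ), (BMS.entropyDeriv W s - BMS.gexit W (p n) (i n) s))
          atTop (𝓝 0) ↔
        ∀ s ∈ Ioc t' 1, Tendsto (fun n => BMS.extrinsicMMSE W (p n) (i n) s) atTop (𝓝 1)) := by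
  obtain ⟨m, D, hD⟩ := hW.exists_isSymmetricDensity
  have he := hW.monotoneOn_entropyTerm hD
  have hE : ∀ t ∈ Icc (0 : ℝ) 1, HasSum (fun k => BMS.entropyTerm m D k t) (BMS.entropyFun W t) :=
    fun t ht => hW.hasSum_entropyTerm hD ht
  have hae := fun n => hW.ae_hasDerivAt_partialEntropy (p n) (i n) hD
  have hg : ∀ n, ∀ᵐ t : ℝ, t ∈ Ioo (0 : ℝ) 1 → HasSum (fun k =>
      BMS.gexitWeight W D (p n) (i n) k t * deriv (BMS.entropyTerm m D k) t)
      (BMS.gexit W (p n) (i n) t) := fun n => by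
    filter_upwards [hae n] with t h ht using (h ht).2
  have hw : ∀ n k, ∀ t ∈ Icc (0 : ℝ) 1, BMS.gexitWeight W D (p n) (i n) k t ∈ Icc (0 : ℝ) 1 :=
    fun n k t ht => hW.gexitWeight_mem_Icc (p n) (i n) hD k ht
  have hwm := fun n k => hW.monotoneOn_gexitWeight (p n) (i n) hD k
  refine ⟨fun n => ⟨?_, (integrableOn_of_ae_hasSum_mul_deriv he hE hW.absolutelyContinuous
    (fun k => (hwm n k).aemeasurable_restrict_Ioo) (hw n) (hg n)).2⟩, fun t' ht' => ?_⟩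
  · rw [← restrict_Ioo_eq_restrict_Icc, ae_restrict_iff' measurableSet_Ioo]
    filter_upwards [hae n] with t h ht using (h ht).1.differentiableWithinAt
  have key := tendsto_integral_iff_of_hasSum_mul_deriv he (hW.strictMonoOn_entropyTerm hM hD) hE
    hW.absolutelyContinuous hw hwm
    (fun n k t ht => by
      have := hW.markov t ht
      exact sub_le_sub_left
        ((hW.isPosteriorMean_extrinsicMean (p n) (i n) hD ht).moment_le_moment_zero k) 1)
    (fun n k t ht => by
      have := hW.markov t ht
      exact (hW.isPosteriorMean_extrinsicMean (p n) (i n) hD ht).one_sub_moment_le k) hg ht'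
  -- The one-sided derivative at the endpoint `1` is irrelevant to the integral; inside,
  -- `derivWithin` is `deriv`.
  have hderiv : ∀ n, ∫ s in t'..(1 : ℝ), (BMS.entropyDeriv W s - BMS.gexit W (p n) (i n) s) =
      ∫ s in t'..(1 : ℝ), (deriv (BMS.entropyFun W) s - BMS.gexit W (p n) (i n) s) := fun n => by
    rw [intervalIntegral.integral_of_le ht'.2.le, intervalIntegral.integral_of_le ht'.2.le,
      integral_Ioc_eq_integral_Ioo, integral_Ioc_eq_integral_Ioo]
    refine setIntegral_congr_fun measurableSet_Ioo fun s hs => ?_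
    simp only [BMS.entropyDeriv]
    rw [derivWithin_of_mem_nhds (Icc_mem_nhds (ht'.1.trans hs.1) hs.2)]
  have hzero : ∀ s ∈ Icc (0 : ℝ) 1, (fun n => BMS.gexitWeight W D (p n) (i n) 0 s) =
      fun n => BMS.extrinsicMMSE W (p n) (i n) s := fun s hs => by
    ext n; exact hW.gexitWeight_zero (p n) (i n) hD hs
  simp_rw [hderiv]
  refine ⟨key.1.trans (forall₂_congr fun s hs => ?_), key.2.trans (forall₂_congr fun s hs => ?_)⟩
  · rw [hzero s ⟨hs.1, (hs.2.trans ht'.2).le⟩]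
  · rw [hzero s ⟨(ht'.1.trans hs.1).le, hs.2⟩]
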